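/- Let $X>0$ be a random variable with law $\mu$ and Laplace transform $\mathcal L(s)=\mathbb E(e^{sX})\in[0,\infty]$, $s\in\mathbb R$. Assume: 1. there is $\alpha>0$ with $\mathcal L(\alpha)<\infty$; 2. there are $c\ge L>0$ and $\tilde\eta\in(0,1)$ such that $\mathbb P(X\in[t_1,t_2])\ge \frac{\tilde\eta}{2L}\int_{t_1}^{t_2}\mathbf 1_{[c-L,c+L]}(r)\,dr$ for all $0\le t_1\le t_2$. Put $\eta=\tilde\eta/2$, assume $\mathbb P(X>c+L)>0$, and let $\bar{\mathcal L}_{c+L}(s)\in[0,\infty]$ be the Laplace transform $\mathbb E(e^{sM})$ of the maximum $M$ of two independent random variables, each distributed as $X$ conditioned on $X>c+L$. For $y\ge0$, a renewal process with delay $y$ is a sequence $(T_n)_{n\ge0}$ such that $T_0=y$ almost surely and the increments $T_{n+1}-T_n$, $n\ge0$, are i.i.d. with law $\mu$; its residual life process $(B^y_t)_{t\ge0}$ is defined by letting $t+B^y_t$ be the first epoch $T_n$ with $T_n>t$. Let $\beta\ge0$ and $\delta\in[0,1)$ be such that $\mathcal L((1+\delta)\beta)<\infty$, and set $$R=\frac1{2\beta}\log\left[\frac{\mathcal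 L((1+\delta)\beta)}{1-\mathcal L(-(1-\delta)\beta)}\right]\quad\text{if }\beta>0,\qquad R=0\quad\text{if }\beta=0.$$ Then for each $x\ge0$ there exist, on some probability space, a renewal process with delay $x$ and a renewal process with delay $0$, with residual life processes $B^x$ and $B^0$, and a finite nonnegative random variable $T^*(x)$ such that almost surely $B^x_t=B^0_t$ for all $t\ge T^*(x)$, and such that $$\mathbb P(T^*(x)>t)\le \exp\{\theta\beta x\mathbf 1_{x>R}\}\;\frac{\eta^{\lceil R/L\rceil}\,e^{\theta\beta\{R+\lfloor R/L\rfloor c\}}\,\bar{\mathcal L}_{c+L}(\theta\beta)}{1-e^{\theta\beta\{R+\lfloor R/L\rfloor c\}}\,\bar{\mathcal L}_{c+L}(\theta\beta)\,(1-\eta^{\lceil R/L\rceil})}\;\exp(-\theta\delta\beta t)$$ for every $t\ge x$ and every $\theta\in(0,1]$ for which $e^{\theta\beta\{R+\lfloor R/L\rfloor c\}}\,\bar{\mathcal L}_{c+L}(\theta\beta)\,(1-\eta^{\lceil R/L\rceil})<1$. -/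

import Mathlib

open MeasureTheory ProbabilityTheory
open scoped ENNReal

/-- `laplace ν s = E[e^{sZ}] ∈ [0, ∞]` for a real random variable `Z` of law `ν`. -/
noncomputable def laplace (ν : Measure ℝ) (s : ℝ) : ℝ≥0∞ :=
  ∫⁻ r, ENNReal.ofReal (Real.exp (s * r)) ∂ν

/-- The law of the maximum of two independent copies of `X ∼ μ`, both conditioned on being
strictly larger than `a` (meaningful when `μ (a, ∞) > 0`). -/
noncomputable def condMaxLaw (μ : Measure ℝ) (a : ℝ) : Measure ℝ :=
  ((cond μ (Set.Ioi a)).prod (cond μ (Set.Ioi a))).map (fun p => max p.1 p.2)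

/-- `laplaceBar μ a` is the Laplace transform of `max (X', X'')`, for independent `X'`, `X''`
distributed as `X ∼ μ` conditioned on `X > a`. -/
noncomputable def laplaceBar (μ : Measure ℝ) (a s : ℝ) : ℝ≥0∞ :=
  laplace (condMaxLaw μ a) s

/-- Exponential moment assumption on the inter-arrival law. -/
def HasExpMoment (μ : Measure ℝ) : Prop :=
  ∃ α : ℝ, 0 < α ∧ laplace μ α < ∞

/-- The law `μ` has a uniform component on `[c - L, c + L]` of mass `ηt`. -/
def HasUniformComponent (μ : Measure ℝ) (c L ηt : ℝ) : Prop :=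
  0 < L ∧ L ≤ c ∧ 0 < ηt ∧ ηt < 1 ∧
    ∀ t₁ t₂ : ℝ, 0 ≤ t₁ → t₁ ≤ t₂ →
      ηt / (2 * L) * ∫ r in t₁..t₂, Set.indicator (Set.Icc (c - L) (c + L)) (fun _ => (1 : ℝ)) r
        ≤ μ.real (Set.Icc t₁ t₂)

/-- `R(δ, β) = (1 / (2β)) log [𝓛((1+δ)β) / (1 - 𝓛(-(1-δ)β))]`. For `β = 0` the formula has no
meaning, and the value here is `0`. -/
noncomputable def criticalRadius (μ : Measure ℝ) (δ β : ℝ) : ℝ :=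
  1 / (2 * β) *
    Real.log ((laplace μ ((1 + δ) * β)).toReal / (1 - (laplace μ (-((1 - δ) * β))).toReal))

/-- `(T n)` is a renewal process on `(Ω, P)` with deterministic delay `x` and inter-arrival law
`μ`: `T 0 = x` a.s., and the increments `T (n+1) - T n` are i.i.d. of law `μ`. -/
structure IsRenewalProcess {Ω : Type*} [MeasurableSpace Ω] (P : Measure Ω) (μ : Measure ℝ)
    (x : ℝ) (T : ℕ → Ω → ℝ) : Prop where
  measurable : ∀ n, Measurable (T n)
  delay : ∀ᵐ ω ∂P, T 0 ω = x
  law : ∀ n, P.map (fun ω => T (n + 1) ω - T n ω) = μ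
  indep : iIndepFun (fun n ω => T (n + 1) ω - T n ω) P

/-- Residual life `B_t = T_{N_t + 1} - t` of a sequence of epochs `T`, where `N_t` is the largest
`n` with `T_n ≤ t`. For increasing `T`, the number `N_t + 1` is the first index `n` with
`T_n > t`; in particular `B_t = T_0 - t` for `t < T_0`. (That index exists almost surely for a
renewal process, because then `T_n → ∞`.) -/
noncomputable def residualLife (T : ℕ → ℝ) (t : ℝ) : ℝ :=
  T (sInf {n : ℕ | t < T n}) - t

/-- `τ` is a (finite) coupling time for the residual life processes of `T` and `T'`. -/
structure IsCouplingTime {Ω : Type*} [MeasurableSpace Ω] (P : Measure Ω)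
    (T T' : ℕ → Ω → ℝ) (τ : Ω → ℝ) : Prop where
  measurable : Measurable τ
  nonneg : ∀ ω, 0 ≤ τ ω
  coalesce : ∀ᵐ ω ∂P, ∀ t : ℝ, τ ω ≤ t →
    residualLife (fun n => T n ω) t = residualLife (fun n => T' n ω) t

/-! Run the two processes together; the one at the later epoch M is the leader, the one at m the
laggard. If the gap M - m exceeds R, the leader waits and the laggard draws an increment. Otherwise
both draw, from a coupling (`exists_shift_coupling`) which on a part of mass η makes the laggard's
increment larger by exactly min(M - m, L). Hence ⌈(M - m)/L⌉ successes in a row merge the epochs,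
and afterwards both use the same increments. The state decides who draws, but each draw has marginal
law μ, so each process is a genuine renewal process (`iid_sideIncrement`): the conditional
probabilities `sideWeight` have constant mean along the chain.

The tail bound comes from a supermartingale (`drift`). With κ = θβ, the potential is e^{κδm} times F
e^{κ(1+δ)(M-m)/2} when the gap exceeds R, and e^{κδm} times e^{κ(M-m)} v_i with i = ⌈(M-m)/L⌉
otherwise; at a meeting at epoch τ it equals e^{κδτ}. For a gap D > R, a jump X of the laggard
multiplies the potential by at most (e^{(1+δ)βX-2βD} + e^{-(1-δ)βX})^{θ/2}. The radius R is chosen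
so that the sum in brackets has mean at most 1 (`criticalRadius_spec`), and Jensen's inequality
handles the power. For a gap at most R, a success costs a factor e^{κc} and lowers i by one. A
failure costs F e^{κ max}, where the maximum of the two residual increments is dominated by that of
two variables conditioned on (c+L, ∞) (`lintegral_residualLaw_le`). Solving the recursion for v_i
turns F into a fixed point F = A(F(1-q)+q), with A = e^{κ(R+⌊R/L⌋c)} times `laplaceBar` at κ, and q
= η^{⌈R/L⌉}; this is the fraction in the bound. Fatou's lemma and Markov's inequality finish the
estimate.

Almost sure meeting needs strictly positive drift. For δ > 0, keep R but drop the time weight from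
the potential: the mean in brackets becomes strictly less than 1, and a small θ makes the cycle
condition hold (`exists_driftParams_unweighted`, `ae_exists_met`). The coupling depends only on x,
μ, R, L, c, η, so one coupling serves all θ. If δβ = 0, the claimed bound is at least 1 and a
coupling built from other rates suffices. -/

/-! ### Comparison of finite measures on the line -/

open Set Filter Topology in
/-- A finite measure on the line that dominates another one on compact intervals dominates it. -/
theorem measure_le_of_Icc_le {ρ μ : Measure ℝ} [IsFiniteMeasure ρ] [IsFiniteMeasure μ]
    (h : ∀ a b, a ≤ b → ρ (Icc a b) ≤ μ (Icc a b)) : ρ ≤ μ := by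
  have hIoc : ∀ a b : ℝ, a < b → ρ (Ioc a b) ≤ μ (Ioc a b) := by
    intro a b hab
    obtain ⟨u, hu, hmem, hlim⟩ := exists_seq_strictAnti_tendsto' hab
    have hU : Ioc a b = ⋃ n, Icc (u n) b := by
      ext y
      simp only [mem_Ioc, mem_iUnion, mem_Icc]
      constructor
      · rintro ⟨h1, h2⟩
        obtain ⟨n, hn⟩ := (hlim.eventually (gt_mem_nhds h1)).exists
        exact ⟨n, hn.le, h2⟩
      · rintro ⟨n, h1, h2⟩
        exact ⟨(hmem n).1.trans_le h1, h2⟩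
    have hmono : Monotone fun n => Icc (u n) b :=
      fun i j hij => Icc_subset_Icc_left (hu.antitone hij)
    rw [hU, hmono.measure_iUnion, hmono.measure_iUnion]
    exact iSup_mono fun n => h _ _ (hmem n).2.le
  have hreal : ∀ (κ : Measure ℝ) [IsFiniteMeasure κ] (a b : ℝ), a ≤ b →
      κ.real (Iic b) = κ.real (Iic a) + κ.real (Ioc a b) := by
    intro κ _ a b hab
    rw [← measureReal_union (by
      rw [Set.disjoint_left]; intro y h1 h2; exact not_lt.2 h1 h2.1) measurableSet_Ioc,
      Iic_union_Ioc_eq_Iic hab]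
  have hcont : ∀ (κ : Measure ℝ) [IsFiniteMeasure κ] (a : ℝ),
      Tendsto (fun b => κ.real (Iic b)) (𝓝[>] a) (𝓝 (κ.real (Iic a))) := by
    intro κ _ a
    have := tendsto_measure_biInter_gt (μ := κ) (s := fun b : ℝ => Iic b) (a := a)
      (fun r _ => measurableSet_Iic.nullMeasurableSet) (fun i j _ hij => Iic_subset_Iic.2 hij)
      ⟨a + 1, by simp, measure_ne_top _ _⟩
    have hI : (⋂ r, ⋂ (_ : r > a), Iic r) = Iic a := by
      ext y
      simp only [mem_iInter, mem_Iic]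
      exact ⟨fun hy => le_of_forall_gt_imp_ge_of_dense hy, fun hy r hr => hy.trans hr.le⟩
    rw [hI] at this
    exact (ENNReal.tendsto_toReal (measure_ne_top _ _)).comp this
  -- The difference of the distribution functions is monotone and right-continuous, so it defines a
  -- measure, which is the missing summand `μ - ρ`.
  let G : StieltjesFunction ℝ :=
    { toFun := fun a => μ.real (Iic a) - ρ.real (Iic a)
      mono' := by
        intro a b hab
        rcases hab.eq_or_lt with rfl | hlt
        · exact le_rfl
        · have h1 := hreal μ a b hab
          have h2 := hreal ρ a b hab
          have h3 : ρ.real (Ioc a b) ≤ μ.real (Ioc a b) :=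
            ENNReal.toReal_mono (measure_ne_top _ _) (hIoc a b hlt)
          simp only [h1, h2]
          linarith
      right_continuous' := by
        intro a
        rw [← continuousWithinAt_Ioi_iff_Ici]
        exact (hcont μ a).sub (hcont ρ a) }
  have key : G.measure + ρ = μ := by
    symm
    refine Measure.ext_of_Ioc _ _ fun a b hab => ?_
    have h1 := hreal μ a b hab.le
    have h2 := hreal ρ a b hab.le
    have h3 : ρ.real (Ioc a b) ≤ μ.real (Ioc a b) :=
      ENNReal.toReal_mono (measure_ne_top _ _) (hIoc a b hab)
    rw [Measure.add_apply, StieltjesFunction.measure_Ioc]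
    have h4 : G b - G a = μ.real (Ioc a b) - ρ.real (Ioc a b) := by
      change (μ.real (Iic b) - ρ.real (Iic b)) - (μ.real (Iic a) - ρ.real (Iic a)) = _
      rw [h1, h2]; ring
    rw [h4, ← ofReal_measureReal (μ := ρ), ← ENNReal.ofReal_add (by linarith) (by positivity),
      sub_add_cancel, ofReal_measureReal]
  rw [← key]
  exact Measure.le_add_left le_rfl

/-! ### The uniform component and the shift coupling of the increment law -/

/-- The sub-law of mass `η` that is uniform on `[c - L, c]`. -/
noncomputable def uniformPart (c L η : ℝ) : Measure ℝ :=
  ENNReal.ofReal (η / L) • volume.restrict (Set.Icc (c - L) c)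

instance (c L η : ℝ) : IsFiniteMeasure (uniformPart c L η) := by
  unfold uniformPart
  exact Measure.smul_finite _ ENNReal.ofReal_ne_top

theorem uniformPart_univ {c L η : ℝ} (hL : 0 < L) :
    uniformPart c L η Set.univ = ENNReal.ofReal η := by
  simp only [uniformPart, Measure.smul_apply, MeasurableSet.univ, Measure.restrict_apply,
    Set.univ_inter, Real.volume_Icc, smul_eq_mul, sub_sub_cancel]
  rw [← ENNReal.ofReal_mul' hL.le, div_mul_cancel₀ _ hL.ne']

theorem ae_uniformPart {c L η : ℝ} : ∀ᵐ y ∂(uniformPart c L η), c - L ≤ y ∧ y ≤ c := by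
  unfold uniformPart
  exact Measure.ae_smul_measure (ae_restrict_mem measurableSet_Icc) _

/-- A translate of `[c - L, c]` by at most `L` stays inside `[c - L, c + L]`, where `μ` has density
at least `ηt / (2L)`. Room for the shift is why only half of the mass `ηt` is used. -/
theorem uniformPart_map_le {μ : Measure ℝ} [IsProbabilityMeasure μ] {c L ηt : ℝ}
    (h : HasUniformComponent μ c L ηt) {l : ℝ} (h0 : 0 ≤ l) (hl : l ≤ L) :
    (uniformPart c L (ηt / 2)).map (· + l) ≤ μ := by
  obtain ⟨hL, hLc, hη0, hη1, hI⟩ := h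
  have h1 : ENNReal.ofReal (ηt / (2 * L)) • volume.restrict (Set.Icc (c - L) (c + L)) ≤ μ := by
    have : IsFiniteMeasure
        (ENNReal.ofReal (ηt / (2 * L)) • (volume : Measure ℝ).restrict (Set.Icc (c - L) (c + L))) :=
      Measure.smul_finite _ ENNReal.ofReal_ne_top
    refine measure_le_of_Icc_le fun a b hab => ?_
    rw [Measure.smul_apply, Measure.restrict_apply measurableSet_Icc, smul_eq_mul]
    -- The assumption covers only intervals in the positive half-line. This loses nothing, because
    -- `c - L ≥ 0`: negative intervals miss the support, and `a` may be replaced by `max a 0`.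
    rcases lt_or_ge b 0 with hb | hb
    · have : Set.Icc a b ∩ Set.Icc (c - L) (c + L) = ∅ := by
        ext y; simp only [Set.mem_inter_iff, Set.mem_Icc, Set.mem_empty_iff_false, iff_false]
        rintro ⟨⟨_, _⟩, _, _⟩; linarith
      simp [this]
    · have hm : max a 0 ≤ b := max_le hab hb
      have h2 := hI (max a 0) b (le_max_right _ _) hm
      rw [intervalIntegral.integral_of_le hm, ← integral_Icc_eq_integral_Ioc,
        setIntegral_indicator measurableSet_Icc, setIntegral_const, smul_eq_mul, mul_one] at h2
      have h3 : Set.Icc a b ∩ Set.Icc (c - L) (c + L)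
          = Set.Icc (max a 0) b ∩ Set.Icc (c - L) (c + L) := by
        ext y
        simp only [Set.mem_inter_iff, Set.mem_Icc, sup_le_iff]
        constructor
        · rintro ⟨⟨_, _⟩, _, _⟩; refine ⟨⟨⟨?_, ?_⟩, ?_⟩, ?_, ?_⟩ <;> linarith
        · rintro ⟨⟨⟨_, _⟩, _⟩, _, _⟩; refine ⟨⟨?_, ?_⟩, ?_, ?_⟩ <;> linarith
      have h4 : volume (Set.Icc (max a 0) b ∩ Set.Icc (c - L) (c + L)) ≠ ∞ :=
        measure_ne_top_of_subset Set.inter_subset_left (by simp)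
      rw [h3, ← ofReal_measureReal h4, ← ENNReal.ofReal_mul (by positivity)]
      refine (ENNReal.ofReal_le_ofReal h2).trans ?_
      rw [ofReal_measureReal]
      exact measure_mono (Set.Icc_subset_Icc_left (le_max_left _ _))
  refine le_trans ?_ h1
  refine Measure.le_iff.2 fun S hS => ?_
  rw [Measure.map_apply (by fun_prop) hS]
  unfold uniformPart
  rw [Measure.smul_apply, Measure.smul_apply, Measure.restrict_apply hS,
    Measure.restrict_apply (hS.preimage (by fun_prop : Measurable (· + l)))]
  have : ηt / 2 / L = ηt / (2 * L) := by field_simp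
  rw [this]
  refine mul_le_mul_right ?_ _
  rw [← measure_preimage_add_right volume l (S ∩ _)]
  refine measure_mono ?_
  rintro y ⟨hy, hy1, hy2⟩
  refine ⟨hy, ?_, ?_⟩ <;> simp only <;> linarith

/-- The normalised remainder of `μ` after the removal of the sub-law `ρ` of mass `η`. -/
noncomputable def residualLaw (μ ρ : Measure ℝ) (η : ℝ) : Measure ℝ :=
  (ENNReal.ofReal (1 - η))⁻¹ • (μ - ρ)

theorem residualLaw_smul {μ ρ : Measure ℝ} {η : ℝ} (hη : η < 1) :
    ENNReal.ofReal (1 - η) • residualLaw μ ρ η = μ - ρ := by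
  rw [residualLaw, smul_smul, ENNReal.mul_inv_cancel (by simpa using hη) ENNReal.ofReal_ne_top,
    one_smul]

theorem isProbabilityMeasure_residualLaw {μ ρ : Measure ℝ} {η : ℝ} [IsProbabilityMeasure μ]
    [IsFiniteMeasure ρ] (hρ : ρ ≤ μ) (hη0 : 0 ≤ η) (hη : η < 1)
    (hmass : ρ Set.univ = ENNReal.ofReal η) : IsProbabilityMeasure (residualLaw μ ρ η) := by
  have h0 : ENNReal.ofReal (1 - η) ≠ 0 := by simpa using hη
  constructor
  rw [residualLaw, Measure.smul_apply, Measure.sub_apply .univ hρ, hmass, measure_univ,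
    smul_eq_mul, ← ENNReal.ofReal_one, ← ENNReal.ofReal_sub _ hη0, ENNReal.inv_mul_cancel h0 ENNReal.ofReal_ne_top, ENNReal.ofReal_one]

theorem residualLaw_absolutelyContinuous {μ ρ : Measure ℝ} {η : ℝ} :
    residualLaw μ ρ η ≪ μ :=
  (Measure.smul_absolutelyContinuous).trans (Measure.absolutelyContinuous_of_le Measure.sub_le)

/-- For every shift `l ∈ [0, L]` the law `μ` has a coupling with itself, measurable in `l`, under
which the two coordinates differ by `l` on a common part `ρ`, and are independent off it. -/
theorem exists_shift_coupling (μ ρ : Measure ℝ) [IsProbabilityMeasure μ] [IsFiniteMeasure ρ]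
    {L η : ℝ} (hL : 0 ≤ L) (hη0 : 0 ≤ η) (hη : η < 1) (hmass : ρ Set.univ = ENNReal.ofReal η)
    (hle : ∀ l, 0 ≤ l → l ≤ L → ρ.map (· + l) ≤ μ) :
    ∃ J : Kernel ℝ (ℝ × ℝ), IsMarkovKernel J ∧ (∀ l, (J l).map Prod.fst = μ) ∧
      (∀ l, (J l).map Prod.snd = μ) ∧
      ∀ l, 0 ≤ l → l ≤ L → ∀ f : ℝ × ℝ → ℝ≥0∞, Measurable f →
        ∫⁻ p, f p ∂(J l) = ∫⁻ y, f (y, y + l) ∂ρ + ENNReal.ofReal (1 - η) *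
          ∫⁻ y₁, ∫⁻ y₂, f (y₁, y₂) ∂(residualLaw μ (ρ.map (· + l)) η) ∂(residualLaw μ ρ η) := by
  -- Clamping the shift gives a Markov kernel on all of `ℝ`, although the translate is a sub-law of
  -- `μ` only for shifts in `[0, L]`.
  let clamp : ℝ → ℝ := fun l => max 0 (min l L)
  have hclamp : Measurable clamp := by fun_prop
  have hc0 : ∀ l, 0 ≤ clamp l := fun l => le_max_left _ _
  have hcL : ∀ l, clamp l ≤ L := fun l => max_le hL (min_le_right _ _)
  have hρ : ρ ≤ μ := by simpa using hle 0 le_rfl hL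
  have hmass' : ∀ l, (ρ.map (· + l)) Set.univ = ENNReal.ofReal η := fun l => by
    rw [Measure.map_apply (by fun_prop) .univ, Set.preimage_univ, hmass]
  have hp0 : IsProbabilityMeasure (residualLaw μ ρ η) :=
    isProbabilityMeasure_residualLaw hρ hη0 hη hmass
  have hp : ∀ l, IsProbabilityMeasure (residualLaw μ (ρ.map (· + clamp l)) η) := fun l =>
    isProbabilityMeasure_residualLaw (hle _ (hc0 l) (hcL l)) hη0 hη (hmass' _)
  let K₁ : Kernel ℝ ℝ :=
    { toFun := fun l => residualLaw μ (ρ.map (· + clamp l)) η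
      measurable' := by
        refine Measure.measurable_of_measurable_coe _ fun S hS => ?_
        have h1 : ∀ l, residualLaw μ (ρ.map (· + clamp l)) η S = (ENNReal.ofReal (1 - η))⁻¹ *
            (μ S - ∫⁻ y, S.indicator 1 (y + clamp l) ∂ρ) := by
          intro l
          rw [residualLaw, Measure.smul_apply, Measure.sub_apply hS (hle _ (hc0 l) (hcL l)),
            ← lintegral_indicator_one hS, ← lintegral_indicator_one hS,
            lintegral_map (measurable_one.indicator hS) (by fun_prop), smul_eq_mul]
        simp_rw [h1]
        refine Measurable.const_mul (Measurable.const_sub ?_ _) _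
        refine Measurable.lintegral_prod_right'
          (f := fun p : ℝ × ℝ => S.indicator (1 : ℝ → ℝ≥0∞) (p.2 + clamp p.1)) ?_
        exact (measurable_one.indicator hS).comp
          (measurable_snd.add (hclamp.comp measurable_fst)) }
  have hK₁ : IsMarkovKernel K₁ := ⟨hp⟩
  let K₀ : Kernel ℝ (ℝ × ℝ) :=
    ((Kernel.const ℝ ρ) ×ₖ (Kernel.id : Kernel ℝ ℝ)).map
      (fun p : ℝ × ℝ => (p.1, p.1 + clamp p.2))
  have hmeas : Measurable (fun p : ℝ × ℝ => (p.1, p.1 + clamp p.2)) := by fun_prop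
  let K₂ : Kernel ℝ (ℝ × ℝ) := (Kernel.const ℝ (residualLaw μ ρ η)) ×ₖ K₁
  let J : Kernel ℝ (ℝ × ℝ) :=
    { toFun := fun l => K₀ l + ENNReal.ofReal (1 - η) • K₂ l
      measurable' := by
        refine Measure.measurable_of_measurable_coe _ fun S hS => ?_
        simp only [Measure.add_apply, Measure.smul_apply, smul_eq_mul]
        exact (K₀.measurable_coe hS).add ((K₂.measurable_coe hS).const_mul _) }
  have hJ : ∀ l (f : ℝ × ℝ → ℝ≥0∞), Measurable f →
      ∫⁻ p, f p ∂(J l) = ∫⁻ y, f (y, y + clamp l) ∂ρ + ENNReal.ofReal (1 - η) *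
        ∫⁻ y₁, ∫⁻ y₂, f (y₁, y₂) ∂(residualLaw μ (ρ.map (· + clamp l)) η)
          ∂(residualLaw μ ρ η) := by
    intro l f hf
    change ∫⁻ p, f p ∂(K₀ l + ENNReal.ofReal (1 - η) • K₂ l) = _
    rw [lintegral_add_measure, lintegral_smul_measure, smul_eq_mul]
    congr 1
    · rw [Kernel.map_apply _ hmeas, lintegral_map hf hmeas, Kernel.prod_apply, Kernel.const_apply,
        Kernel.id_apply, lintegral_prod (fun a : ℝ × ℝ => f (a.1, a.1 + clamp a.2)) (hf.comp hmeas).aemeasurable]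
      refine lintegral_congr fun y => ?_
      rw [lintegral_dirac' _ (f := fun z => f (y, y + clamp z))]
      exact hf.comp (by fun_prop)
    · rw [Kernel.prod_apply, Kernel.const_apply, lintegral_prod _ hf.aemeasurable]
      rfl
  have hsplit : ∀ l, 0 ≤ l → l ≤ L → ∀ S, MeasurableSet S →
      ρ.map (· + l) S + ENNReal.ofReal (1 - η) * residualLaw μ (ρ.map (· + l)) η S = μ S := by
    intro l h0 hl S hS
    have h1 := congrArg (fun κ : Measure ℝ => κ S)
      (residualLaw_smul (μ := μ) (ρ := ρ.map (· + l)) hη)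
    simp only [Measure.smul_apply, smul_eq_mul] at h1
    rw [h1, ← Measure.add_apply, add_comm, Measure.sub_add_cancel_of_le (hle l h0 hl)]
  have hsplit0 : ∀ S, MeasurableSet S →
      ρ S + ENNReal.ofReal (1 - η) * residualLaw μ ρ η S = μ S := by
    simpa using hsplit 0 le_rfl hL
  have hfst : ∀ l, (J l).map Prod.fst = μ := by
    intro l
    ext S hS
    rw [Measure.map_apply measurable_fst hS, ← lintegral_indicator_one (measurable_fst hS),
      hJ l _ (measurable_one.indicator (measurable_fst hS)), ← hsplit0 S hS]
    have := hp l
    congr 1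
    · rw [← lintegral_indicator_one hS]; rfl
    · congr 1
      rw [← lintegral_indicator_one hS]
      refine lintegral_congr fun y₁ => ?_
      have : ∀ y₂ : ℝ, (Prod.fst ⁻¹' S).indicator (1 : ℝ × ℝ → ℝ≥0∞) (y₁, y₂)
        = S.indicator 1 y₁ := fun y₂ => rfl
      simp [this]
  have hsnd : ∀ l, (J l).map Prod.snd = μ := by
    intro l
    ext S hS
    rw [Measure.map_apply measurable_snd hS, ← lintegral_indicator_one (measurable_snd hS),
      hJ l _ (measurable_one.indicator (measurable_snd hS)), ← hsplit _ (hc0 l) (hcL l) S hS]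
    congr 1
    · rw [← lintegral_indicator_one hS, lintegral_map (measurable_one.indicator hS) (by fun_prop)]
      rfl
    · congr 1
      rw [← lintegral_indicator_one hS]
      have : ∀ y₁ y₂ : ℝ, (Prod.snd ⁻¹' S).indicator (1 : ℝ × ℝ → ℝ≥0∞) (y₁, y₂)
        = S.indicator 1 y₂ := fun _ y₂ => rfl
      simp [this]
  refine ⟨J, ⟨fun l => ⟨?_⟩⟩, hfst, hsnd, ?_⟩
  · have := congrArg (fun κ : Measure ℝ => κ Set.univ) (hfst l)
    simpa [Measure.map_apply measurable_fst MeasurableSet.univ] using this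
  · intro l h0 hl f hf
    have : clamp l = l := by simp [clamp, min_eq_left hl, max_eq_right h0]
    simpa only [this] using hJ l f hf

/-- The remainder of `μ` off a sub-law carried by `(-∞, a]` is stochastically dominated by `μ`
conditioned on `(a, ∞)`. -/
theorem lintegral_residualLaw_le {μ ρ : Measure ℝ} [IsProbabilityMeasure μ] [IsFiniteMeasure ρ]
    {η a : ℝ} (hρ : ρ ≤ μ) (hη0 : 0 ≤ η) (hη : η < 1) (hmass : ρ Set.univ = ENNReal.ofReal η)
    (hsupp : ρ (Set.Ioi a) = 0) (ha : 0 < μ (Set.Ioi a)) {h : ℝ → ℝ≥0∞} (hh : Monotone h) :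
    ∫⁻ y, h y ∂(residualLaw μ ρ η) ≤ ∫⁻ y, h y ∂(cond μ (Set.Ioi a)) := by
  have hp := isProbabilityMeasure_residualLaw hρ hη0 hη hmass
  have hc : IsProbabilityMeasure (cond μ (Set.Ioi a)) := cond_isProbabilityMeasure ha.ne'
  have hm : Measurable h := hh.measurable
  set ν := residualLaw μ ρ η
  set I := ∫⁻ y, h y ∂(cond μ (Set.Ioi a))
  have hmem : ∀ᵐ y ∂(cond μ (Set.Ioi a)), y ∈ Set.Ioi a := by
    rw [ProbabilityTheory.cond]
    exact Measure.ae_smul_measure (ae_restrict_mem measurableSet_Ioi) _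
  have hI : h a ≤ I := by
    calc h a = ∫⁻ _, h a ∂(cond μ (Set.Ioi a)) := by simp
      _ ≤ I := lintegral_mono_ae (by
        filter_upwards [hmem] with y hy using hh (le_of_lt hy))
  -- Nothing was removed above `a`, so there the remainder is proportional to `μ`. Below `a`,
  -- monotonicity gives `h ≤ h a ≤ I`.
  have hres : ν.restrict (Set.Ioi a) = ν (Set.Ioi a) • cond μ (Set.Ioi a) := by
    ext S hS
    have h1 : ∀ U, MeasurableSet U → U ⊆ Set.Ioi a →
        ν U = (ENNReal.ofReal (1 - η))⁻¹ * μ U := by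
      intro U hU hUs
      change (ENNReal.ofReal (1 - η))⁻¹ * (μ - ρ) U = _
      rw [Measure.sub_apply hU hρ, measure_mono_null hUs hsupp, tsub_zero]
    rw [Measure.restrict_apply hS, Measure.smul_apply, cond_apply measurableSet_Ioi,
      h1 _ (hS.inter measurableSet_Ioi) Set.inter_subset_right, h1 _ measurableSet_Ioi subset_rfl,
      smul_eq_mul, Set.inter_comm S, mul_assoc, ← mul_assoc (μ (Set.Ioi a)),
      ENNReal.mul_inv_cancel ha.ne' (measure_ne_top _ _), one_mul]
  rw [← lintegral_add_compl h measurableSet_Ioi (A := Set.Ioi a), hres, lintegral_smul_measure,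
    smul_eq_mul]
  have h2 : ∫⁻ y in (Set.Ioi a)ᶜ, h y ∂ν ≤ ν (Set.Ioi a)ᶜ * I := by
    calc ∫⁻ y in (Set.Ioi a)ᶜ, h y ∂ν ≤ ∫⁻ _ in (Set.Ioi a)ᶜ, I ∂ν :=
          setLIntegral_mono' measurableSet_Ioi.compl
            fun y hy => (hh (not_lt.1 hy)).trans hI
      _ = ν (Set.Ioi a)ᶜ * I := by simp [mul_comm]
  calc _ ≤ ν (Set.Ioi a) * I + ν (Set.Ioi a)ᶜ * I := by gcongr
    _ = I := by rw [← add_mul, prob_add_prob_compl measurableSet_Ioi, one_mul]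

/-- `laplaceBar` as an iterated integral dominates the corresponding integral for residual laws. -/
theorem lintegral_max_residualLaw_le {μ ρ ρ' : Measure ℝ} [IsProbabilityMeasure μ]
    [IsFiniteMeasure ρ] [IsFiniteMeasure ρ'] {η a s : ℝ} (hs : 0 ≤ s) (hρ : ρ ≤ μ) (hρ' : ρ' ≤ μ)
    (hη0 : 0 ≤ η) (hη : η < 1) (hmass : ρ Set.univ = ENNReal.ofReal η)
    (hmass' : ρ' Set.univ = ENNReal.ofReal η) (hsupp : ρ (Set.Ioi a) = 0)
    (hsupp' : ρ' (Set.Ioi a) = 0) (ha : 0 < μ (Set.Ioi a)) :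
    ∫⁻ y₁, ∫⁻ y₂, ENNReal.ofReal (Real.exp (s * max y₁ y₂)) ∂(residualLaw μ ρ' η)
      ∂(residualLaw μ ρ η) ≤ laplaceBar μ a s := by
  have hc : IsProbabilityMeasure (cond μ (Set.Ioi a)) := cond_isProbabilityMeasure ha.ne'
  have hmono : ∀ y, Monotone fun z => ENNReal.ofReal (Real.exp (s * max y z)) := fun y z w hzw =>
    ENNReal.ofReal_le_ofReal (Real.exp_le_exp.2
      (mul_le_mul_of_nonneg_left (max_le_max le_rfl hzw) hs))
  calc _ ≤ ∫⁻ y₁, ∫⁻ y₂, ENNReal.ofReal (Real.exp (s * max y₁ y₂)) ∂(cond μ (Set.Ioi a))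
          ∂(residualLaw μ ρ η) :=
        lintegral_mono fun y₁ => lintegral_residualLaw_le hρ' hη0 hη hmass' hsupp' ha (hmono y₁)
    _ ≤ ∫⁻ y₁, ∫⁻ y₂, ENNReal.ofReal (Real.exp (s * max y₁ y₂)) ∂(cond μ (Set.Ioi a))
          ∂(cond μ (Set.Ioi a)) := by
        refine lintegral_residualLaw_le hρ hη0 hη hmass hsupp ha fun z w hzw => ?_
        refine lintegral_mono fun y => ?_
        simpa only [max_comm y] using hmono y hzw
    _ = laplaceBar μ a s := by
        rw [laplaceBar, laplace, condMaxLaw, lintegral_map (by fun_prop) (by fun_prop),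
          lintegral_prod _ (by fun_prop)]

/-! ### The Markov chain of the two processes -/

/-- A partially constructed renewal process: the current epoch, the number of increments used so
far, and the list of these increments. -/
abbrev Side : Type := ℝ × ℕ × (ℕ → ℝ)

/-- Adds the increment `u`. -/
def Side.advance (s : Side) (u : ℝ) : Side :=
  (s.1 + u, s.2.1 + 1, Function.update s.2.2 s.2.1 u)

/-- The move of `s` in the presence of the other process `o`: it waits if it is ahead by more than
`R`; otherwise it uses the increment `y.1` of the leader, or the increment `y.2` of the laggard. -/
noncomputable def Side.move (R : ℝ) (s o : Side) (y : ℝ × ℝ) : Side :=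
  if R < s.1 - o.1 then s else s.advance (if o.1 ≤ s.1 then y.1 else y.2)

/-- Two partially constructed renewal processes, and the later of their current epochs, which is
frozen once the epochs agree. -/
abbrev PairState : Type := Side × Side × ℝ

/-- The two processes have met. -/
def PairState.Met (z : PairState) : Prop := z.1.1 = z.2.1.1

/-- One step of the pair, with increments `y`. -/
noncomputable def PairState.move (R : ℝ) (z : PairState) (y : ℝ × ℝ) : PairState :=
  (z.1.move R z.2.1 y, z.2.1.move R z.1 y,
    if z.1.1 = z.2.1.1 then z.2.2 else max (z.1.move R z.2.1 y).1 (z.2.1.move R z.1 y).1)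

/-- The shift that the coupling of the next increments is to realise. -/
noncomputable def PairState.shift (L : ℝ) (z : PairState) : ℝ := min |z.1.1 - z.2.1.1| L

/-- The chain driven by the seeds `ω`, where `g l` turns a seed into a pair of increments. -/
noncomputable def pairChain (R L : ℝ) (g : ℝ → unitInterval → ℝ × ℝ) (z : PairState) :
    ℕ → (ℕ → unitInterval) → PairState
  | 0, _ => z
  | n + 1, ω => (pairChain R L g z n ω).move R (g ((pairChain R L g z n ω).shift L) (ω n))

theorem measurable_advance : Measurable fun p : Side × ℝ => p.1.advance p.2 := by
  unfold Side.advance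
  refine Measurable.prodMk (by fun_prop) (Measurable.prodMk (by fun_prop) ?_)
  refine measurable_pi_lambda _ fun i => ?_
  simp only [Function.update_apply]
  refine Measurable.ite ?_ (by fun_prop) (by fun_prop)
  exact measurableSet_eq_fun measurable_const (by fun_prop)

theorem measurable_sideMove (R : ℝ) :
    Measurable fun p : (Side × Side) × (ℝ × ℝ) => p.1.1.move R p.1.2 p.2 := by
  unfold Side.move
  refine Measurable.ite (measurableSet_lt (by fun_prop) (by fun_prop)) (by fun_prop) ?_
  exact measurable_advance.comp (Measurable.prodMk (by fun_prop)
    (Measurable.ite (measurableSet_le (by fun_prop) (by fun_prop)) (by fun_prop) (by fun_prop)))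

theorem measurable_pairMove (R : ℝ) :
    Measurable fun p : PairState × (ℝ × ℝ) => p.1.move R p.2 := by
  have h1 : Measurable fun p : PairState × (ℝ × ℝ) => p.1.1.move R p.1.2.1 p.2 :=
    (measurable_sideMove R).comp (f := fun p : PairState × (ℝ × ℝ) => ((p.1.1, p.1.2.1), p.2))
      (by fun_prop)
  have h2 : Measurable fun p : PairState × (ℝ × ℝ) => p.1.2.1.move R p.1.1 p.2 :=
    (measurable_sideMove R).comp (f := fun p : PairState × (ℝ × ℝ) => ((p.1.2.1, p.1.1), p.2))
      (by fun_prop)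
  unfold PairState.move
  refine h1.prodMk (h2.prodMk ?_)
  exact Measurable.ite (measurableSet_eq_fun (by fun_prop) (by fun_prop)) (by fun_prop)
    (h1.fst.max h2.fst)

theorem measurable_shift (L : ℝ) : Measurable fun z : PairState => z.shift L := by
  unfold PairState.shift
  have : Measurable fun z : PairState => z.1.1 - z.2.1.1 := by fun_prop
  exact (measurable_norm.comp this).min measurable_const

theorem measurableSet_met : MeasurableSet {z : PairState | z.Met} :=
  measurableSet_eq_fun (by fun_prop) (by fun_prop)

section Chain

variable {R L : ℝ} {g : ℝ → unitInterval → ℝ × ℝ} {z : PairState}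

/-- Step `n` reads only seed `n`, so the state before it is a function of the earlier seeds. This
factorisation through finitely many coordinates makes the state independent of the next seed. -/
theorem exists_pairChain_eq_restrict (hg : Measurable (Function.uncurry g)) (n : ℕ) :
    ∃ φ : (Finset.range n → unitInterval) → PairState, Measurable φ ∧
      ∀ ω, pairChain R L g z n ω = φ fun i => ω i := by
  induction n with
  | zero => exact ⟨fun _ => z, measurable_const, fun _ => rfl⟩
  | succ n ih =>
    obtain ⟨φ, hφ, h⟩ := ih
    have hr : Measurable fun (w : Finset.range (n + 1) → unitInterval) (i : Finset.range n) =>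
        w ⟨i, Finset.range_mono n.le_succ i.2⟩ :=
      measurable_pi_lambda _ fun i => measurable_pi_apply _
    have hφr := hφ.comp hr
    refine ⟨fun w => (φ fun i => w ⟨i, Finset.range_mono n.le_succ i.2⟩).move R
      (g ((φ fun i => w ⟨i, Finset.range_mono n.le_succ i.2⟩).shift L)
        (w ⟨n, Finset.self_mem_range_succ n⟩)), ?_, fun ω => by simp only [pairChain, h]⟩
    exact (measurable_pairMove R).comp (hφr.prodMk
      (hg.comp (((measurable_shift L).comp hφr).prodMk (measurable_pi_apply _))))

theorem measurable_pairChain (hg : Measurable (Function.uncurry g)) (n : ℕ) :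
    Measurable (pairChain R L g z n) := by
  obtain ⟨φ, hφ, h⟩ := exists_pairChain_eq_restrict (R := R) (L := L) (z := z) hg n
  have : pairChain R L g z n = φ ∘ fun ω i => ω i := funext h
  rw [this]
  exact hφ.comp (measurable_pi_lambda _ fun i => measurable_pi_apply _)

/-- The law of the seeds. -/
noncomputable def seedLaw : Measure (ℕ → unitInterval) :=
  Measure.infinitePi fun _ => (volume : Measure unitInterval)

instance : IsProbabilityMeasure seedLaw := by unfold seedLaw; infer_instance

theorem indepFun_pairChain_eval (hg : Measurable (Function.uncurry g)) (n : ℕ) :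
    IndepFun (pairChain R L g z n) (fun ω => ω n) seedLaw := by
  obtain ⟨φ, hφ, h⟩ := exists_pairChain_eq_restrict (R := R) (L := L) (z := z) hg n
  have hind : iIndepFun (fun (i : ℕ) (ω : ℕ → unitInterval) => ω i) seedLaw :=
    iIndepFun_infinitePi (X := fun _ => id) fun _ => measurable_id
  have h1 := hind.indepFun_finset (Finset.range n) {n} (by simp) fun i => measurable_pi_apply i
  have h2 := h1.comp hφ
    (measurable_pi_apply (⟨n, Finset.mem_singleton_self n⟩ : ({n} : Finset ℕ)))
  have : pairChain R L g z n = φ ∘ fun ω i => ω i := funext h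
  rw [this]
  exact h2

/-- The Markov property of the chain. -/
theorem lintegral_pairChain_succ (hg : Measurable (Function.uncurry g)) {J : Kernel ℝ (ℝ × ℝ)}
    (hJ : ∀ l, Measure.map (g l) volume = J l) (n : ℕ) {f : PairState → ℝ≥0∞} (hf : Measurable f) :
    ∫⁻ ω, f (pairChain R L g z (n + 1) ω) ∂seedLaw =
      ∫⁻ ω, ∫⁻ y, f ((pairChain R L g z n ω).move R y) ∂(J ((pairChain R L g z n ω).shift L))
        ∂seedLaw := by
  have hm := measurable_pairChain (R := R) (L := L) (z := z) hg n
  have he : Measurable fun ω : ℕ → unitInterval => ω n := measurable_pi_apply n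
  have hlaw := (indepFun_iff_map_prod_eq_prod_map_map hm.aemeasurable he.aemeasurable).1
    (indepFun_pairChain_eval (R := R) (L := L) (z := z) hg n)
  have hev : seedLaw.map (fun ω => ω n) = volume :=
    Measure.infinitePi_map_eval (fun _ => (volume : Measure unitInterval)) n
  have hF : Measurable fun p : PairState × unitInterval => f (p.1.move R (g (p.1.shift L) p.2)) :=
    hf.comp ((measurable_pairMove R).comp (measurable_fst.prodMk
      (hg.comp (((measurable_shift L).comp measurable_fst).prodMk measurable_snd))))
  calc ∫⁻ ω, f (pairChain R L g z (n + 1) ω) ∂seedLaw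
      = ∫⁻ p, f (p.1.move R (g (p.1.shift L) p.2))
          ∂(seedLaw.map fun ω => (pairChain R L g z n ω, ω n)) := by
        rw [lintegral_map hF (hm.prodMk he)]; rfl
    _ = ∫⁻ w, ∫⁻ u, f (w.move R (g (w.shift L) u)) ∂volume
          ∂(seedLaw.map (pairChain R L g z n)) := by
        rw [hlaw, hev, lintegral_prod _ hF.aemeasurable]
    _ = ∫⁻ ω, ∫⁻ u, f ((pairChain R L g z n ω).move R (g ((pairChain R L g z n ω).shift L) u))
          ∂volume ∂seedLaw := by
        rw [lintegral_map hF.lintegral_prod_right' hm]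
    _ = _ := by
        refine lintegral_congr fun ω => ?_
        have hgl : Measurable (g ((pairChain R L g z n ω).shift L)) :=
          hg.comp measurable_prodMk_left
        rw [← hJ, lintegral_map _ hgl]
        exact hf.comp ((measurable_pairMove R).comp measurable_prodMk_left)

end Chain

/-! ### Pathwise bookkeeping of the increments -/

section Pathwise

variable {R x : ℝ} {s o : ℕ → Side} {y : ℕ → ℝ × ℝ}

/-- The index at which the two sequences of sides first meet. -/
noncomputable def meetIndex (s o : ℕ → Side) : ℕ := sInf {n | (s n).1 = (o n).1}

/-- The increments of the process `s`, read off after the meeting with `o`. -/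
noncomputable def sideIncrement (s o : ℕ → Side) (i : ℕ) : ℝ := (s (meetIndex s o + i + 1)).2.2 i

theorem count_mono (hs : ∀ n, s (n + 1) = (s n).move R (o n) (y n)) :
    Monotone fun n => (s n).2.1 := by
  refine monotone_nat_of_le_succ fun n => ?_
  rw [hs, Side.move]
  split_ifs
  · exact le_rfl
  all_goals exact Nat.le_succ _

/-- A move writes only in the slot indexed by the current count, and the count never decreases. -/
theorem history_stable (hs : ∀ n, s (n + 1) = (s n).move R (o n) (y n)) {n m i : ℕ}
    (hnm : n ≤ m) (hi : i < (s n).2.1) : (s m).2.2 i = (s n).2.2 i := by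
  induction m, hnm using Nat.le_induction with
  | base => rfl
  | succ m hm ih =>
    have h1 : i < (s m).2.1 := hi.trans_le (count_mono hs hm)
    rw [← ih, hs, Side.move]
    split_ifs
    · rfl
    all_goals exact Function.update_of_ne h1.ne _ _

theorem position_eq (hs : ∀ n, s (n + 1) = (s n).move R (o n) (y n)) (h0 : (s 0).1 = x)
    (h0' : (s 0).2.1 = 0) (n : ℕ) :
    (s n).1 = x + ∑ i ∈ Finset.range (s n).2.1, (s n).2.2 i := by
  have key : ∀ (t : Side) (u : ℝ), t.1 = x + ∑ i ∈ Finset.range t.2.1, t.2.2 i →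
      (t.advance u).1 = x + ∑ i ∈ Finset.range (t.advance u).2.1, (t.advance u).2.2 i := by
    intro t u ht
    have : ∑ i ∈ Finset.range t.2.1, Function.update t.2.2 t.2.1 u i
        = ∑ i ∈ Finset.range t.2.1, t.2.2 i :=
      Finset.sum_congr rfl fun i hi =>
        Function.update_of_ne (Finset.mem_range.1 hi).ne _ _
    simp only [Side.advance, Finset.sum_range_succ, Function.update_self, this]
    rw [ht]; ring
  induction n with
  | zero => simp [h0, h0']
  | succ n ih =>
    rw [hs, Side.move]
    split_ifs
    · exact ih
    all_goals exact key _ _ ih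

/-- At equal epochs nobody waits, since `0 ≤ R`, and both sides pass the leader test `≤`; hence both
use the first coordinate of the draw. -/
theorem met_succ (hR : 0 ≤ R) (hs : ∀ n, s (n + 1) = (s n).move R (o n) (y n))
    (ho : ∀ n, o (n + 1) = (o n).move R (s n) (y n))
    {n : ℕ} (h : (s n).1 = (o n).1) : (s (n + 1)).1 = (o (n + 1)).1 := by
  rw [hs, ho, Side.move, Side.move]
  simp [h, hR.not_gt, Side.advance]

theorem met_of_le (hR : 0 ≤ R) (hs : ∀ n, s (n + 1) = (s n).move R (o n) (y n))
    (ho : ∀ n, o (n + 1) = (o n).move R (s n) (y n))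
    {n m : ℕ} (hnm : n ≤ m) (h : (s n).1 = (o n).1) : (s m).1 = (o m).1 := by
  induction m, hnm using Nat.le_induction with
  | base => exact h
  | succ m hm ih => exact met_succ hR hs ho ih

theorem count_of_met (hR : 0 ≤ R) (hs : ∀ n, s (n + 1) = (s n).move R (o n) (y n))
    (ho : ∀ n, o (n + 1) = (o n).move R (s n) (y n))
    {n : ℕ} (h : (s n).1 = (o n).1) (j : ℕ) :
    (s (n + j)).2.1 = (s n).2.1 + j := by
  induction j with
  | zero => rfl
  | succ j ih =>
    have h1 := met_of_le hR hs ho (Nat.le_add_right n j) h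
    rw [← add_assoc, hs, Side.move]
    simp only [h1, sub_self, hR.not_gt, if_false, Side.advance]
    omega

/-- After the meeting every step uses one increment, so slot `i` is filled by the time `meetIndex s
o + i + 1`; filled slots do not change. -/
theorem sideIncrement_eq (hR : 0 ≤ R) (hs : ∀ n, s (n + 1) = (s n).move R (o n) (y n))
    (ho : ∀ n, o (n + 1) = (o n).move R (s n) (y n))
    (hmet : ∃ n, (s n).1 = (o n).1) {n i : ℕ} (hi : i < (s n).2.1) :
    sideIncrement s o i = (s n).2.2 i := by
  have hp : (s (meetIndex s o)).1 = (o (meetIndex s o)).1 := Nat.sInf_mem hmet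
  have hc : i < (s (meetIndex s o + i + 1)).2.1 := by
    rw [add_assoc, count_of_met hR hs ho hp]; omega
  rw [sideIncrement]
  rcases le_total n (meetIndex s o + i + 1) with h | h
  · exact history_stable hs h hi
  · exact (history_stable hs h hc).symm

theorem position_eq_sum_sideIncrement (hR : 0 ≤ R) (hs : ∀ n, s (n + 1) = (s n).move R (o n) (y n))
    (ho : ∀ n, o (n + 1) = (o n).move R (s n) (y n))
    (h0 : (s 0).1 = x) (h0' : (s 0).2.1 = 0)
    (hmet : ∃ n, (s n).1 = (o n).1) (n : ℕ) :
    (s n).1 = x + ∑ i ∈ Finset.range (s n).2.1, sideIncrement s o i := by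
  rw [position_eq hs h0 h0' n]
  congr 1
  exact Finset.sum_congr rfl fun i hi =>
    (sideIncrement_eq hR hs ho hmet (Finset.mem_range.1 hi)).symm

end Pathwise

open Filter in
/-- Two nondecreasing unbounded sequences of epochs that share an epoch `τ` and agree from then on
have the same residual life after `τ`. -/
theorem residualLife_eq_of_agree {T T' : ℕ → ℝ} (hT : Monotone T) (hT' : Monotone T')
    (hlim : Tendsto T atTop atTop) {p q : ℕ} (h : ∀ j, T (p + j) = T' (q + j)) {t : ℝ}
    (ht : T p ≤ t) : residualLife T t = residualLife T' t := by
  -- The first index past `t` may be searched from `r` on, which removes the different offsets `p`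
  -- and `q` of the two sequences.
  have key : ∀ (S : ℕ → ℝ) (r : ℕ), Monotone S → S r ≤ t → (∃ j, t < S (r + j)) →
      sInf {n | t < S n} = r + sInf {j | t < S (r + j)} := by
    intro S r hS hr hex
    have hex' : {j | t < S (r + j)}.Nonempty := hex
    refine le_antisymm (Nat.sInf_le (Nat.sInf_mem hex')) ?_
    obtain ⟨j, hj⟩ := hex
    have hmem : t < S (sInf {n | t < S n}) := Nat.sInf_mem (s := {n | t < S n}) ⟨r + j, hj⟩
    have hlt : r < sInf {n | t < S n} := by
      by_contra hcon
      exact absurd (hS (not_lt.1 hcon)) (not_le.2 (hr.trans_lt hmem))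
    obtain ⟨k, hk⟩ := Nat.exists_eq_add_of_le hlt.le
    rw [hk] at hmem ⊢
    exact Nat.add_le_add_left (Nat.sInf_le hmem) _
  have hex : ∃ j, t < T (p + j) := by
    obtain ⟨n, hn⟩ := (hlim.eventually_gt_atTop t).exists
    exact ⟨n, hn.trans_le (hT (Nat.le_add_left n p))⟩
  have hset : {j | t < T (p + j)} = {j | t < T' (q + j)} := by simp only [h]
  have hq : T' q ≤ t := by rw [← add_zero q, ← h 0]; exact ht
  unfold residualLife
  rw [key T p hT ht hex, key T' q hT' hq (by simpa only [h] using hex), hset, h]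

/-! ### The increments of each side are i.i.d. -/

/-- Joint factorisation of all finite-dimensional rectangles characterises i.i.d. sequences. -/
theorem iid_of_lintegral_prod {Ω : Type*} [MeasurableSpace Ω] {P : Measure Ω}
    {μ : Measure ℝ} [IsProbabilityMeasure μ] {X : ℕ → Ω → ℝ}
    (hX : ∀ i, Measurable (X i))
    (h : ∀ (m : ℕ) (B : ℕ → Set ℝ), (∀ i, MeasurableSet (B i)) →
      ∫⁻ ω, ∏ i ∈ Finset.range m, (B i).indicator 1 (X i ω) ∂P
        = ∏ i ∈ Finset.range m, μ (B i)) :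
    (∀ i, P.map (X i) = μ) ∧ iIndepFun X P := by
  classical
  have key : ∀ (S : Finset ℕ) (B : ℕ → Set ℝ), (∀ i ∈ S, MeasurableSet (B i)) →
      P (⋂ i ∈ S, X i ⁻¹' B i) = ∏ i ∈ S, μ (B i) := by
    intro S B hB
    -- Padding with `univ`, whose factors are all 1, reduces an arbitrary finite index set to an
    -- initial segment.
    let C : ℕ → Set ℝ := fun i => if i ∈ S then B i else Set.univ
    have hC : ∀ i, MeasurableSet (C i) := by
      intro i
      by_cases hi : i ∈ S
      · simpa [C, hi] using hB i hi
      · simp [C, hi]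
    have hS : S ⊆ Finset.range (S.sup id + 1) := fun i hi =>
      Finset.mem_range.2 (Nat.lt_succ_of_le (Finset.le_sup (f := id) hi))
    have h1 := h (S.sup id + 1) C hC
    have h2 : ∏ i ∈ Finset.range (S.sup id + 1), μ (C i) = ∏ i ∈ S, μ (B i) := by
      rw [← Finset.prod_subset hS fun i _ hi => by simp [C, hi]]
      exact Finset.prod_congr rfl fun i hi => by simp [C, hi]
    have h3 : ∀ ω, ∏ i ∈ Finset.range (S.sup id + 1), (C i).indicator (1 : ℝ → ℝ≥0∞) (X i ω)
        = (⋂ i ∈ S, X i ⁻¹' B i).indicator 1 ω := by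
      intro ω
      rw [← Finset.prod_subset hS fun i _ hi => by simp [C, hi]]
      by_cases hω : ω ∈ ⋂ i ∈ S, X i ⁻¹' B i
      · rw [Set.indicator_of_mem hω]
        refine Finset.prod_eq_one fun i hi => ?_
        simp only [Set.mem_iInter, Set.mem_preimage] at hω
        simp [C, hi, hω i hi]
      · rw [Set.indicator_of_notMem hω]
        simp only [Set.mem_iInter, Set.mem_preimage, not_forall] at hω
        obtain ⟨i, hi, hn⟩ := hω
        exact Finset.prod_eq_zero hi (by simp [C, hi, hn])
    have hms : MeasurableSet (⋂ i ∈ S, X i ⁻¹' B i) :=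
      MeasurableSet.biInter S.countable_toSet fun i hi => hX i (hB i hi)
    simp only [h3] at h1
    rw [lintegral_indicator_one hms] at h1
    rw [h1, h2]
  have hlaw : ∀ i B, MeasurableSet B → P (X i ⁻¹' B) = μ B := by
    intro i B hB
    simpa using key {i} (fun _ => B) fun _ _ => hB
  refine ⟨fun i => ?_, ?_⟩
  · ext B hB
    rw [Measure.map_apply (hX i) hB, hlaw i B hB]
  · rw [iIndepFun_iff_measure_inter_preimage_eq_mul]
    intro S B hB
    rw [key S B hB]
    exact Finset.prod_congr rfl fun i hi => (hlaw i _ (hB i hi)).symm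

/-- The conditional probability, given the increments used so far, that the `i`-th increment lies
in `B i` for all `i < m`. -/
noncomputable def sideWeight (μ : Measure ℝ) (B : ℕ → Set ℝ) (m : ℕ) (s : Side) : ℝ≥0∞ :=
  ∏ i ∈ Finset.range m, if i < s.2.1 then (B i).indicator 1 (s.2.2 i) else μ (B i)

section Weight

variable {μ : Measure ℝ} {B : ℕ → Set ℝ} {m : ℕ}

theorem measurable_sideWeight (hB : ∀ i, MeasurableSet (B i)) :
    Measurable (sideWeight μ B m) := by
  unfold sideWeight
  refine Finset.measurable_prod _ fun i _ => ?_
  refine Measurable.ite (measurableSet_lt measurable_const (by fun_prop)) ?_ measurable_const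
  exact (measurable_one.indicator (hB i)).comp
    ((measurable_pi_apply i).comp (measurable_snd.comp measurable_snd))

variable [IsProbabilityMeasure μ]

theorem sideWeight_le_one (s : Side) : sideWeight μ B m s ≤ 1 := by
  refine Finset.prod_le_one' fun i _ => ?_
  split_ifs
  · exact Set.indicator_le_self _ _ _
  · exact prob_le_one

/-- Only the factor of the newly used increment changes, from `μ (B i)` to an indicator with this
mean. If `m` increments have been used already, nothing changes. -/
theorem lintegral_sideWeight_advance (hB : ∀ i, MeasurableSet (B i)) (s : Side) :
    ∫⁻ u, sideWeight μ B m (s.advance u) ∂μ = sideWeight μ B m s := by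
  have hne : ∀ u i, i ≠ s.2.1 →
      (if i < (s.advance u).2.1 then (B i).indicator (1 : ℝ → ℝ≥0∞) ((s.advance u).2.2 i)
        else μ (B i)) = if i < s.2.1 then (B i).indicator 1 (s.2.2 i) else μ (B i) := by
    intro u i hi
    have h1 : i < (s.advance u).2.1 ↔ i < s.2.1 := by simp only [Side.advance]; omega
    simp only [h1]
    simp only [Side.advance, Function.update_of_ne hi]
  rcases le_or_gt m s.2.1 with hm | hm
  · have : ∀ u, sideWeight μ B m (s.advance u) = sideWeight μ B m s := fun u =>
      Finset.prod_congr rfl fun i hi =>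
        hne u i ((Finset.mem_range.1 hi).trans_le hm).ne
    simp [this]
  · have hmem := Finset.mem_range.2 hm
    have h1 : ∀ u, sideWeight μ B m (s.advance u) = (B s.2.1).indicator 1 u *
        ∏ i ∈ (Finset.range m).erase s.2.1,
          if i < s.2.1 then (B i).indicator 1 (s.2.2 i) else μ (B i) := by
      intro u
      rw [sideWeight, ← Finset.mul_prod_erase _ _ hmem]
      congr 1
      · simp [Side.advance]
      · exact Finset.prod_congr rfl fun i hi => hne u i (Finset.ne_of_mem_erase hi)
    simp only [h1]
    rw [lintegral_mul_const _ (measurable_one.indicator (hB _)), lintegral_indicator_one (hB _),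
      sideWeight, ← Finset.mul_prod_erase _ _ hmem]
    simp

/-- A side either waits or reads one coordinate of the draw, chosen by the present state. Only the
marginals of `Q` enter, so the dependence between coordinates does no harm. -/
theorem lintegral_sideWeight_move (hB : ∀ i, MeasurableSet (B i)) {Q : Measure (ℝ × ℝ)}
    [IsProbabilityMeasure Q]
    (h1 : Q.map Prod.fst = μ) (h2 : Q.map Prod.snd = μ) (R : ℝ) (s o : Side) :
    ∫⁻ y, sideWeight μ B m (s.move R o y) ∂Q = sideWeight μ B m s := by
  have hmeas : Measurable fun u => sideWeight μ B m (s.advance u) :=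
    (measurable_sideWeight hB).comp (measurable_advance.comp measurable_prodMk_left)
  unfold Side.move
  split_ifs
  · simp
  · rw [← lintegral_sideWeight_advance (μ := μ) hB s]
    nth_rw 2 [← h1]
    rw [lintegral_map hmeas measurable_fst]
  · rw [← lintegral_sideWeight_advance (μ := μ) hB s]
    nth_rw 2 [← h2]
    rw [lintegral_map hmeas measurable_snd]

end Weight

section Sides

variable {Ω : Type*} [MeasurableSpace Ω] {P : Measure Ω} [IsProbabilityMeasure P]

theorem measurable_meetIndex {s o : ℕ → Ω → Side} (hs : ∀ n, Measurable (s n))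
    (ho : ∀ n, Measurable (o n)) :
    Measurable fun ω => meetIndex (fun n => s n ω) (fun n => o n ω) := by
  have hE : ∀ n, MeasurableSet {ω | (s n ω).1 = (o n ω).1} := fun n =>
    measurableSet_eq_fun (hs n).fst (ho n).fst
  refine measurable_of_Iic fun k => ?_
  -- The event of never meeting is included because the infimum of the empty set of naturals is 0.
  have : (fun ω => meetIndex (fun n => s n ω) (fun n => o n ω)) ⁻¹' Set.Iic k
      = (⋃ n ∈ Set.Iic k, {ω | (s n ω).1 = (o n ω).1}) ∪ ⋂ n, {ω | (s n ω).1 = (o n ω).1}ᶜ := by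
    ext ω
    simp only [Set.mem_preimage, Set.mem_Iic, Set.mem_union, Set.mem_iUnion, Set.mem_ofPred_eq,
      Set.mem_iInter, Set.mem_compl_iff, meetIndex]
    constructor
    · intro h
      by_cases hex : ∃ n, (s n ω).1 = (o n ω).1
      · exact Or.inl ⟨_, h, Nat.sInf_mem hex⟩
      · exact Or.inr (not_exists.1 hex)
    · rintro (⟨n, hn, h⟩ | h)
      · exact (Nat.sInf_le h).trans hn
      · have : {n | (s n ω).1 = (o n ω).1} = ∅ := Set.eq_empty_of_forall_notMem h
        simp [this]
  rw [this]
  exact (MeasurableSet.biUnion (Set.to_countable _) fun n _ => hE n).union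
    (MeasurableSet.iInter fun n => (hE n).compl)

theorem measurable_sideIncrement {s o : ℕ → Ω → Side} (hs : ∀ n, Measurable (s n))
    (ho : ∀ n, Measurable (o n)) (i : ℕ) :
    Measurable fun ω => sideIncrement (fun n => s n ω) (fun n => o n ω) i := by
  have h1 : Measurable fun p : ℕ × Ω => (s (p.1 + i + 1) p.2).2.2 i :=
    measurable_from_prod_countable_right fun n =>
      (measurable_pi_apply i).comp (hs (n + i + 1)).snd.snd
  exact h1.comp ((measurable_meetIndex hs ho).prodMk measurable_id)

open Filter Topology in
/-- If the weights of one side are fair along the construction and the two sides meet almost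
surely, then the increments of that side are i.i.d. of law `μ`. -/
theorem iid_sideIncrement {μ : Measure ℝ} [IsProbabilityMeasure μ] {R : ℝ} (hR : 0 ≤ R)
    {s o : ℕ → Ω → Side} {y : ℕ → Ω → ℝ × ℝ} (hsm : ∀ n, Measurable (s n))
    (hom : ∀ n, Measurable (o n))
    (hs : ∀ n ω, s (n + 1) ω = (s n ω).move R (o n ω) (y n ω))
    (ho : ∀ n ω, o (n + 1) ω = (o n ω).move R (s n ω) (y n ω))
    (h0 : ∀ ω, (s 0 ω).2.1 = 0)
    (hw : ∀ (m : ℕ) (B : ℕ → Set ℝ), (∀ i, MeasurableSet (B i)) → ∀ n,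
      ∫⁻ ω, sideWeight μ B m (s (n + 1) ω) ∂P = ∫⁻ ω, sideWeight μ B m (s n ω) ∂P)
    (hmet : ∀ᵐ ω ∂P, ∃ n, (s n ω).1 = (o n ω).1) :
    (∀ i, P.map (fun ω => sideIncrement (fun n => s n ω) (fun n => o n ω) i) = μ) ∧
      iIndepFun (fun i ω => sideIncrement (fun n => s n ω) (fun n => o n ω) i) P := by
  refine iid_of_lintegral_prod (measurable_sideIncrement hsm hom) fun m B hB => ?_
  have hconst : ∀ n, ∫⁻ ω, sideWeight μ B m (s n ω) ∂P = ∏ i ∈ Finset.range m, μ (B i) := by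
    intro n
    induction n with
    | zero => simp [sideWeight, h0]
    | succ n ih => rw [hw m B hB, ih]
  -- The weights are bounded by 1 and become constant once `m` increments are used, so their
  -- constant mean passes to the limit.
  have hlim : Tendsto (fun n => ∫⁻ ω, sideWeight μ B m (s n ω) ∂P) atTop
      (𝓝 (∫⁻ ω, ∏ i ∈ Finset.range m, (B i).indicator 1
        (sideIncrement (fun n => s n ω) (fun n => o n ω) i) ∂P)) := by
    refine tendsto_lintegral_of_dominated_convergence (fun _ => 1)
      (fun n => (measurable_sideWeight hB).comp (hsm n))
      (fun n => Eventually.of_forall fun ω => sideWeight_le_one _) (by simp) ?_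
    filter_upwards [hmet] with ω hω
    have hp : (s (meetIndex (fun n => s n ω) fun n => o n ω) ω).1
        = (o (meetIndex (fun n => s n ω) fun n => o n ω) ω).1 := Nat.sInf_mem hω
    refine tendsto_const_nhds.congr' ?_
    filter_upwards [eventually_ge_atTop (meetIndex (fun n => s n ω) (fun n => o n ω) + m)]
      with n hn
    refine Finset.prod_congr rfl fun i hi => ?_
    have hi' := Finset.mem_range.1 hi
    have hc : i < (s n ω).2.1 := by
      have h1 := count_of_met (s := fun n => s n ω) (o := fun n => o n ω) hR
        (fun n => hs n ω) (fun n => ho n ω) hp m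
      have h2 := count_mono (s := fun n => s n ω) (fun n => hs n ω) hn
      simp only at h1 h2
      omega
    rw [if_pos hc, sideIncrement_eq (s := fun n => s n ω) (o := fun n => o n ω) hR
        (fun n => hs n ω) (fun n => ho n ω) hω hc]
  simp only [hconst] at hlim
  exact tendsto_nhds_unique hlim tendsto_const_nhds |>.symm ▸ rfl

end Sides

/-! ### The Lyapunov function and its drift -/

/-- The parameters of the Lyapunov function: the exponent is `θ * β`, the rate of decay `dl`, the
range of the coupling attempts `R`; `v i` is the cost of an attempt with `i` steps to go, `F` the
cost of a full cycle, `ε` the drift, `r` the contraction of the gap when it exceeds `R`. -/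
structure DriftParams (μ : Measure ℝ) (β θ dl R c L η lam ε F r : ℝ) (v : ℕ → ℝ) : Prop where
  β_nonneg : 0 ≤ β
  θ_nonneg : 0 ≤ θ
  dl_nonneg : 0 ≤ dl
  dl_le : dl ≤ 1
  R_nonneg : 0 ≤ R
  L_pos : 0 < L
  L_le : L ≤ c
  η_nonneg : 0 ≤ η
  η_lt : η < 1
  lam_nonneg : 0 ≤ lam
  ε_nonneg : 0 ≤ ε
  F_nonneg : 0 ≤ F
  v_zero : v 0 = 1
  v_nonneg : ∀ i, 0 ≤ v i
  v_succ : ∀ i, (1 - η) * lam * F + η * Real.exp (θ * β * c) * v i + ε ≤ v (i + 1)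
  v_le : ∀ i, i ≤ ⌈R / L⌉₊ → Real.exp (θ * β * R) * v i ≤ F
  bar_le : laplaceBar μ (c + L) (θ * β) ≤ ENNReal.ofReal lam
  r_nonneg : 0 ≤ r
  jump : ∀ D, R < D → ∫⁻ X, ENNReal.ofReal ((Real.exp ((1 + dl) * β * X - 2 * β * D)
    + Real.exp (-((1 - dl) * β * X))) ^ (θ / 2)) ∂μ ≤ ENNReal.ofReal r
  jump_slack : F * r + ε ≤ F

/-- The Lyapunov function, for epochs `m ≤ M`. -/
noncomputable def gapPotential (κ dl R L F : ℝ) (v : ℕ → ℝ) (m M : ℝ) : ℝ :=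
  Real.exp (κ * dl * m) * (if M - m ≤ R then Real.exp (κ * (M - m)) * v ⌈(M - m) / L⌉₊
    else F * Real.exp (κ * (1 + dl) * (M - m) / 2))

/-- The Lyapunov function of the pair of processes, frozen when they meet. -/
noncomputable def pairPotential (κ dl R L F : ℝ) (v : ℕ → ℝ) (z : PairState) : ℝ :=
  if z.1.1 = z.2.1.1 then Real.exp (κ * dl * z.2.2)
  else gapPotential κ dl R L F v (min z.1.1 z.2.1.1) (max z.1.1 z.2.1.1)

theorem measurable_pairPotential (κ dl R L F : ℝ) (v : ℕ → ℝ) :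
    Measurable (pairPotential κ dl R L F v) := by
  unfold pairPotential gapPotential
  have hv : Measurable v := measurable_from_nat
  refine Measurable.ite (measurableSet_eq_fun (by fun_prop) (by fun_prop)) (by fun_prop) ?_
  refine Measurable.mul (by fun_prop) (Measurable.ite
    (measurableSet_le (by fun_prop) (by fun_prop)) (Measurable.mul (by fun_prop) ?_) (by fun_prop))
  exact hv.comp (Nat.measurable_ceil.comp (by fun_prop))

/-- The same pair with the roles exchanged. -/
def PairState.swap (z : PairState) : PairState := (z.2.1, z.1, z.2.2)

theorem PairState.move_swap (R : ℝ) (z : PairState) (y : ℝ × ℝ) :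
    z.swap.move R y = (z.move R y).swap := by
  simp only [PairState.move, PairState.swap, max_comm, @eq_comm ℝ z.2.1.1]

theorem PairState.shift_swap (L : ℝ) (z : PairState) : z.swap.shift L = z.shift L := by
  simp only [PairState.shift, PairState.swap, abs_sub_comm]

theorem pairPotential_swap (κ dl R L F : ℝ) (v : ℕ → ℝ) (z : PairState) :
    pairPotential κ dl R L F v z.swap = pairPotential κ dl R L F v z := by
  simp only [pairPotential, PairState.swap, max_comm, min_comm, @eq_comm ℝ z.2.1.1]

/-- A successful attempt lowers the number of remaining steps by exactly one, also when the last
step is shorter than `L`. -/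
theorem ceil_sub_min_div {D L : ℝ} (hL : 0 < L) (hD : 0 < D) :
    ⌈(D - min D L) / L⌉₊ + 1 = ⌈D / L⌉₊ := by
  rcases le_total D L with h | h
  · rw [min_eq_left h, sub_self, zero_div, Nat.ceil_zero, zero_add]
    refine le_antisymm ?_ ?_
    · exact Nat.one_le_ceil_iff.2 (by positivity)
    · exact Nat.ceil_le.2 (by rw [div_le_iff₀ hL]; simpa using h)
  · rw [min_eq_right h, ← Nat.ceil_add_one (by apply div_nonneg <;> linarith)]
    congr 1
    field_simp
    ring

section Drift

variable {μ : Measure ℝ} {β θ dl R c L η lam ε F r : ℝ} {v : ℕ → ℝ}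

local notation "W" => gapPotential (θ * β) dl R L F v
local notation "V" => pairPotential (θ * β) dl R L F v

/-- The frozen value fits continuously: for zero gap the function equals its time weight, because `v
0 = 1`. No separate case for a meeting is then needed after a move. -/
theorem pairPotential_move (h : DriftParams μ β θ dl R c L η lam ε F r v) {z : PairState}
    (hz : z.1.1 ≠ z.2.1.1) (y : ℝ × ℝ) :
    V (z.move R y) = W (min (z.move R y).1.1 (z.move R y).2.1.1)
      (max (z.move R y).1.1 (z.move R y).2.1.1) := by
  have ht : (z.move R y).2.2 = max (z.move R y).1.1 (z.move R y).2.1.1 := by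
    simp only [PairState.move, if_neg hz]
  unfold pairPotential
  split_ifs with hm
  · rw [ht, hm, max_self, min_self, gapPotential]
    simp [h.R_nonneg, h.v_zero]
  · rfl

/-- The outer branch is an upper bound everywhere, since `F` dominates the cost of any attempt with
gap at most `R`. Its exponent is linear in `m` and `M`, so its change under a jump is explicit. -/
theorem gapPotential_le (h : DriftParams μ β θ dl R c L η lam ε F r v) {m M : ℝ} (hmM : m ≤ M) :
    W m M ≤ F * Real.exp (θ * β / 2 * ((1 + dl) * M - (1 - dl) * m)) := by
  have hκ : 0 ≤ θ * β := mul_nonneg h.θ_nonneg h.β_nonneg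
  have hexp : Real.exp (θ * β / 2 * ((1 + dl) * M - (1 - dl) * m))
      = Real.exp (θ * β * dl * m) * Real.exp (θ * β * (1 + dl) * (M - m) / 2) := by
    rw [← Real.exp_add]; congr 1; ring
  rw [gapPotential, hexp, mul_left_comm]
  refine mul_le_mul_of_nonneg_left ?_ (Real.exp_pos _).le
  split_ifs with hR
  · have h1 : Real.exp (θ * β * (M - m)) * v ⌈(M - m) / L⌉₊ ≤ F := by
      refine le_trans (mul_le_mul_of_nonneg_right (Real.exp_le_exp.2
        (mul_le_mul_of_nonneg_left hR hκ)) (h.v_nonneg _)) (h.v_le _ (Nat.ceil_mono ?_))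
      exact div_le_div_of_nonneg_right hR h.L_pos.le
    refine h1.trans (le_mul_of_one_le_right h.F_nonneg (Real.one_le_exp ?_))
    have := h.dl_nonneg
    have : 0 ≤ M - m := by linarith
    positivity
  · exact le_rfl

/-- With `l = min (M - m) L`, the time weight grows by at most `θ * β * (c + l)` in the exponent,
while closing the gap gains `θ * β * l`; the net cost is `θ * β * c`. -/
theorem gapPotential_success (h : DriftParams μ β θ dl R c L η lam ε F r v) {m M y : ℝ}
    (hmM : m < M) (hR : M - m ≤ R) (hy : y ≤ c) :
    W (m + (y + min (M - m) L)) (M + y) ≤ Real.exp (θ * β * dl * m) *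
      Real.exp (θ * β * (M - m)) * (Real.exp (θ * β * c) * v (⌈(M - m) / L⌉₊ - 1)) := by
  have hκ : 0 ≤ θ * β := mul_nonneg h.θ_nonneg h.β_nonneg
  have hl0 : 0 ≤ min (M - m) L := le_min (by linarith) h.L_pos.le
  have hgap : M + y - (m + (y + min (M - m) L)) = (M - m) - min (M - m) L := by ring
  have hceil := ceil_sub_min_div h.L_pos (sub_pos.2 hmM)
  have hc : 0 ≤ c := h.L_pos.le.trans h.L_le
  rw [gapPotential, hgap, if_pos (by linarith), ← hceil, Nat.add_sub_cancel, ← mul_assoc,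
    ← mul_assoc, ← Real.exp_add, ← Real.exp_add, ← Real.exp_add]
  refine mul_le_mul_of_nonneg_right (Real.exp_le_exp.2 ?_) (h.v_nonneg _)
  have h1 : θ * β * dl * (y + min (M - m) L) ≤ θ * β * (c + min (M - m) L) := by
    calc θ * β * dl * (y + min (M - m) L) ≤ θ * β * dl * (c + min (M - m) L) :=
          mul_le_mul_of_nonneg_left (by linarith) (mul_nonneg hκ h.dl_nonneg)
      _ ≤ θ * β * (c + min (M - m) L) :=
          mul_le_mul_of_nonneg_right (mul_le_of_le_one_right hκ h.dl_le) (by linarith)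
  linarith

/-- The earlier epoch does not fall below `m`, and the later one gains at most `max y₁ y₂`,
whichever side ends up ahead. -/
theorem gapPotential_failure (h : DriftParams μ β θ dl R c L η lam ε F r v) {m M y₁ y₂ : ℝ}
    (hmM : m ≤ M) (hy₁ : 0 ≤ y₁) (hy₂ : 0 ≤ y₂) :
    W (min (m + y₂) (M + y₁)) (max (m + y₂) (M + y₁)) ≤ Real.exp (θ * β * dl * m) *
      Real.exp (θ * β * (M - m)) * (F * Real.exp (θ * β * max y₁ y₂)) := by
  have hκ : 0 ≤ θ * β := mul_nonneg h.θ_nonneg h.β_nonneg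
  refine (gapPotential_le h min_le_max).trans ?_
  rw [mul_left_comm, ← Real.exp_add, ← Real.exp_add]
  refine mul_le_mul_of_nonneg_left (Real.exp_le_exp.2 ?_) h.F_nonneg
  have h1 : m ≤ min (m + y₂) (M + y₁) := le_min (by linarith) (by linarith)
  have h2 : max (m + y₂) (M + y₁) ≤ M + max y₁ y₂ :=
    max_le (by linarith [le_max_right y₁ y₂]) (by linarith [le_max_left y₁ y₂])
  have h3 : 0 ≤ max y₁ y₂ := hy₁.trans (le_max_left _ _)
  have hd0 := h.dl_nonneg
  have hd1 := h.dl_le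
  have h4 : (1 + dl) * max (m + y₂) (M + y₁) - (1 - dl) * min (m + y₂) (M + y₁)
      ≤ (1 + dl) * (M + max y₁ y₂) - (1 - dl) * m :=
    sub_le_sub (mul_le_mul_of_nonneg_left h2 (by linarith))
      (mul_le_mul_of_nonneg_left h1 (by linarith))
  have h5 : (1 + dl) * (M + max y₁ y₂) - (1 - dl) * m
      ≤ 2 * (dl * m + (M - m) + max y₁ y₂) := by nlinarith
  calc θ * β / 2 * ((1 + dl) * max (m + y₂) (M + y₁) - (1 - dl) * min (m + y₂) (M + y₁))
      ≤ θ * β / 2 * (2 * (dl * m + (M - m) + max y₁ y₂)) :=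
        mul_le_mul_of_nonneg_left (h4.trans h5) (by linarith)
    _ = _ := by ring

/-- One summand is the exact factor when the laggard overtakes, the other when it stays behind.
Keeping both removes the case distinction before integration. -/
theorem gapPotential_jump (h : DriftParams μ β θ dl R c L η lam ε F r v) {m M : ℝ} (X : ℝ) :
    W (min (m + X) M) (max (m + X) M) ≤
      F * Real.exp (θ * β / 2 * ((1 + dl) * M - (1 - dl) * m)) *
      (Real.exp ((1 + dl) * β * X - 2 * β * (M - m)) + Real.exp (-((1 - dl) * β * X))) ^ (θ / 2) := by
  refine (gapPotential_le h min_le_max).trans ?_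
  rw [mul_assoc]
  refine mul_le_mul_of_nonneg_left ?_ h.F_nonneg
  have hθ : 0 ≤ θ / 2 := by have := h.θ_nonneg; positivity
  have hpow : ∀ u, Real.exp (θ / 2 * u) = Real.exp u ^ (θ / 2) := fun u => by
    rw [← Real.exp_mul, mul_comm]
  rcases le_total (m + X) M with hX | hX
  · rw [min_eq_left hX, max_eq_right hX]
    calc _ = Real.exp (θ * β / 2 * ((1 + dl) * M - (1 - dl) * m)) *
          Real.exp (-((1 - dl) * β * X)) ^ (θ / 2) := by
          rw [← hpow, ← Real.exp_add]; congr 1; ring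
      _ ≤ _ := by
          refine mul_le_mul_of_nonneg_left (Real.rpow_le_rpow (Real.exp_pos _).le ?_ hθ)
            (Real.exp_pos _).le
          exact le_add_of_nonneg_left (Real.exp_pos _).le
  · rw [min_eq_right hX, max_eq_left hX]
    calc _ = Real.exp (θ * β / 2 * ((1 + dl) * M - (1 - dl) * m)) *
          Real.exp ((1 + dl) * β * X - 2 * β * (M - m)) ^ (θ / 2) := by
          rw [← hpow, ← Real.exp_add]; congr 1; ring
      _ ≤ _ := by
          refine mul_le_mul_of_nonneg_left (Real.rpow_le_rpow (Real.exp_pos _).le ?_ hθ)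
            (Real.exp_pos _).le
          exact le_add_of_nonneg_right (Real.exp_pos _).le

/-- The properties of the coupling of the increments that the drift estimate uses. -/
structure IsShiftCoupling (μ ρ : Measure ℝ) (L η : ℝ) (J : Kernel ℝ (ℝ × ℝ)) : Prop where
  markov : IsMarkovKernel J
  map_fst : ∀ l, (J l).map Prod.fst = μ
  map_snd : ∀ l, (J l).map Prod.snd = μ
  lintegral_eq : ∀ l, 0 ≤ l → l ≤ L → ∀ f : ℝ × ℝ → ℝ≥0∞, Measurable f →
    ∫⁻ p, f p ∂(J l) = ∫⁻ y, f (y, y + l) ∂ρ + ENNReal.ofReal (1 - η) *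
      ∫⁻ y₁, ∫⁻ y₂, f (y₁, y₂) ∂(residualLaw μ (ρ.map (· + l)) η) ∂(residualLaw μ ρ η)

theorem measurable_pairMove_right (R : ℝ) (z : PairState) : Measurable (z.move R) :=
  (measurable_pairMove R).comp measurable_prodMk_left

/-- Drift while the gap exceeds `R`. -/
theorem drift_of_gap_gt (h : DriftParams μ β θ dl R c L η lam ε F r v) {ρ : Measure ℝ}
    {J : Kernel ℝ (ℝ × ℝ)} (hJ : IsShiftCoupling μ ρ L η J) {z : PairState}
    (hz : R < z.2.1.1 - z.1.1) :
    ∫⁻ y, ENNReal.ofReal (V (z.move R y)) ∂(J (z.shift L))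
      + ENNReal.ofReal (ε * Real.exp (θ * β * dl * min z.1.1 z.2.1.1)) ≤ ENNReal.ofReal (V z) := by
  have hR := h.R_nonneg
  have hlt : z.1.1 < z.2.1.1 := by linarith
  set m := z.1.1 with hm
  set M := z.2.1.1 with hM
  set Φ := Real.exp (θ * β / 2 * ((1 + dl) * M - (1 - dl) * m)) with hΦ
  have hVz : V z = F * Φ := by
    rw [pairPotential, if_neg (by rw [← hm, ← hM]; exact hlt.ne), ← hm, ← hM, min_eq_left hlt.le,
      max_eq_right hlt.le, gapPotential, if_neg (not_le.2 hz), mul_left_comm, ← Real.exp_add, hΦ]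
    congr 2; ring
  have hmove : ∀ y : ℝ × ℝ, V (z.move R y) = W (min (m + y.2) M) (max (m + y.2) M) := by
    intro y
    rw [pairPotential_move h (by rw [← hm, ← hM]; exact hlt.ne)]
    have h1 : (z.move R y).1.1 = m + y.2 := by
      simp only [PairState.move, Side.move, ← hm, ← hM]
      rw [if_neg (by linarith), if_neg (not_le.2 hlt)]; rfl
    have h2 : (z.move R y).2.1.1 = M := by
      simp only [PairState.move, Side.move, ← hm, ← hM]
      rw [if_pos hz]
    rw [h1, h2]
  -- This lets the slack in `jump_slack`, scaled by `Φ`, pay for the drift term.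
  have hΦm : Real.exp (θ * β * dl * m) ≤ Φ := by
    refine Real.exp_le_exp.2 ?_
    have hκ : 0 ≤ θ * β := mul_nonneg h.θ_nonneg h.β_nonneg
    have : 0 ≤ θ * β * ((1 + dl) * (M - m)) :=
      mul_nonneg hκ (mul_nonneg (by linarith [h.dl_nonneg]) (by linarith))
    nlinarith
  have hFΦ : 0 ≤ F * Φ := mul_nonneg h.F_nonneg (Real.exp_pos _).le
  have hint : ∫⁻ y, ENNReal.ofReal (V (z.move R y)) ∂(J (z.shift L)) ≤
      ENNReal.ofReal (F * Φ * r) := by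
    have hg : Measurable fun X : ℝ => ENNReal.ofReal (F * Φ * (Real.exp ((1 + dl) * β * X
        - 2 * β * (M - m)) + Real.exp (-((1 - dl) * β * X))) ^ (θ / 2)) := by fun_prop
    calc _ ≤ ∫⁻ y : ℝ × ℝ, ENNReal.ofReal (F * Φ * (Real.exp ((1 + dl) * β * y.2
          - 2 * β * (M - m)) + Real.exp (-((1 - dl) * β * y.2))) ^ (θ / 2)) ∂(J (z.shift L)) := by
          refine lintegral_mono fun y => ?_
          rw [hmove]
          exact ENNReal.ofReal_le_ofReal (gapPotential_jump h _)
      _ = ∫⁻ X, ENNReal.ofReal (F * Φ * (Real.exp ((1 + dl) * β * X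
          - 2 * β * (M - m)) + Real.exp (-((1 - dl) * β * X))) ^ (θ / 2)) ∂μ := by
          rw [← hJ.map_snd (z.shift L), lintegral_map hg measurable_snd]
      _ ≤ _ := by
          simp_rw [ENNReal.ofReal_mul hFΦ]
          rw [lintegral_const_mul _ (by fun_prop)]
          exact mul_le_mul_right (h.jump _ hz) _
  rw [hVz, min_eq_left hlt.le]
  calc _ ≤ ENNReal.ofReal (F * Φ * r) + ENNReal.ofReal (ε * Real.exp (θ * β * dl * m)) := by gcongr
    _ = ENNReal.ofReal (F * Φ * r + ε * Real.exp (θ * β * dl * m)) := by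
        rw [ENNReal.ofReal_add (mul_nonneg hFΦ h.r_nonneg)
          (mul_nonneg h.ε_nonneg (Real.exp_pos _).le)]
    _ ≤ _ := by
        refine ENNReal.ofReal_le_ofReal ?_
        have h1 : ε * Real.exp (θ * β * dl * m) ≤ ε * Φ :=
          mul_le_mul_of_nonneg_left hΦm h.ε_nonneg
        have h2 : (F * r + ε) * Φ ≤ F * Φ :=
          mul_le_mul_of_nonneg_right h.jump_slack (Real.exp_pos _).le
        linarith

/-- Drift during a coupling attempt. -/
theorem drift_of_gap_le (h : DriftParams μ β θ dl R c L η lam ε F r v) [IsProbabilityMeasure μ]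
    (hμ : ∀ᵐ x ∂μ, 0 < x) (hcond : 0 < μ (Set.Ioi (c + L)))
    (hle : ∀ l, 0 ≤ l → l ≤ L → (uniformPart c L η).map (· + l) ≤ μ)
    {J : Kernel ℝ (ℝ × ℝ)} (hJ : IsShiftCoupling μ (uniformPart c L η) L η J) {z : PairState}
    (hlt : z.1.1 < z.2.1.1) (hz : z.2.1.1 - z.1.1 ≤ R) :
    ∫⁻ y, ENNReal.ofReal (V (z.move R y)) ∂(J (z.shift L))
      + ENNReal.ofReal (ε * Real.exp (θ * β * dl * min z.1.1 z.2.1.1)) ≤ ENNReal.ofReal (V z) := by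
  have hR := h.R_nonneg
  have hκ : 0 ≤ θ * β := mul_nonneg h.θ_nonneg h.β_nonneg
  set m := z.1.1 with hm
  set M := z.2.1.1 with hM
  set ρ := uniformPart c L η with hρdef
  set l := min (M - m) L with hl
  have hl0 : 0 ≤ l := le_min (by linarith) h.L_pos.le
  have hlL : l ≤ L := min_le_right _ _
  have hshift : z.shift L = l := by
    rw [PairState.shift, ← hm, ← hM, abs_sub_comm, abs_of_pos (by linarith)]
  set i := ⌈(M - m) / L⌉₊ with hi
  -- The gap is positive, so `i ≥ 1` and the truncated subtraction is a genuine one.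
  have hi1 : i - 1 + 1 = i := by
    have := ceil_sub_min_div h.L_pos (sub_pos.2 hlt)
    omega
  set Φ := Real.exp (θ * β * dl * m) * Real.exp (θ * β * (M - m)) with hΦ
  have hΦ0 : 0 ≤ Φ := by positivity
  have hVz : V z = Φ * v i := by
    rw [pairPotential, if_neg (by rw [← hm, ← hM]; exact hlt.ne), ← hm, ← hM, min_eq_left hlt.le,
      max_eq_right hlt.le, gapPotential, if_pos hz, ← mul_assoc]
  have hmove : ∀ y : ℝ × ℝ, V (z.move R y)
      = W (min (m + y.2) (M + y.1)) (max (m + y.2) (M + y.1)) := by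
    intro y
    rw [pairPotential_move h (by rw [← hm, ← hM]; exact hlt.ne)]
    have h1 : (z.move R y).1.1 = m + y.2 := by
      simp only [PairState.move, Side.move, ← hm, ← hM]
      rw [if_neg (by linarith), if_neg (not_le.2 hlt)]; rfl
    have h2 : (z.move R y).2.1.1 = M + y.1 := by
      simp only [PairState.move, Side.move, ← hm, ← hM]
      rw [if_neg (not_lt.2 hz), if_pos hlt.le]; rfl
    rw [h1, h2]
  have hsucc : ∫⁻ y, ENNReal.ofReal (V (z.move R (y, y + l))) ∂ρ ≤
      ENNReal.ofReal (Φ * (η * Real.exp (θ * β * c) * v (i - 1))) := by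
    calc _ ≤ ∫⁻ _, ENNReal.ofReal (Φ * (Real.exp (θ * β * c) * v (i - 1))) ∂ρ := by
          refine lintegral_mono_ae ?_
          filter_upwards [ae_uniformPart (c := c) (L := L) (η := η)] with y hy
          rw [hmove]
          have hle' : m + (y + l) ≤ M + y := by
            have : l ≤ M - m := min_le_left _ _
            linarith
          simp only [min_eq_left hle', max_eq_right hle']
          exact ENNReal.ofReal_le_ofReal (gapPotential_success h hlt hz hy.2)
      _ = _ := by
          rw [lintegral_const, uniformPart_univ h.L_pos, ← ENNReal.ofReal_mul' h.η_nonneg]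
          congr 1; ring
  have hfail : ∫⁻ y₁, ∫⁻ y₂, ENNReal.ofReal (V (z.move R (y₁, y₂)))
      ∂(residualLaw μ (ρ.map (· + l)) η) ∂(residualLaw μ ρ η) ≤ ENNReal.ofReal (Φ * F * lam) := by
    -- Positivity of the increments passes to the residual laws by absolute continuity.
    have hac : ∀ ρ' : Measure ℝ, ∀ᵐ y ∂(residualLaw μ ρ' η), 0 < y := fun ρ' =>
      residualLaw_absolutelyContinuous.ae_le hμ
    have hmass : ρ Set.univ = ENNReal.ofReal η := uniformPart_univ h.L_pos
    have hΦF : 0 ≤ Φ * F := mul_nonneg hΦ0 h.F_nonneg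
    calc _ ≤ ∫⁻ y₁, ∫⁻ y₂, ENNReal.ofReal (Φ * F) *
            ENNReal.ofReal (Real.exp (θ * β * max y₁ y₂))
            ∂(residualLaw μ (ρ.map (· + l)) η) ∂(residualLaw μ ρ η) := by
          refine lintegral_mono_ae ?_
          filter_upwards [hac ρ] with y₁ hy₁
          refine lintegral_mono_ae ?_
          filter_upwards [hac (ρ.map (· + l))] with y₂ hy₂
          rw [hmove, ← ENNReal.ofReal_mul hΦF, mul_assoc]
          exact ENNReal.ofReal_le_ofReal (gapPotential_failure h hlt.le hy₁.le hy₂.le)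
      _ = ENNReal.ofReal (Φ * F) * ∫⁻ y₁, ∫⁻ y₂, ENNReal.ofReal (Real.exp (θ * β * max y₁ y₂))
            ∂(residualLaw μ (ρ.map (· + l)) η) ∂(residualLaw μ ρ η) := by
          rw [← lintegral_const_mul' _ _ ENNReal.ofReal_ne_top]
          refine lintegral_congr fun y₁ => ?_
          rw [← lintegral_const_mul' _ _ ENNReal.ofReal_ne_top]
      _ ≤ ENNReal.ofReal (Φ * F) * ENNReal.ofReal lam := by
          refine mul_le_mul_right (le_trans ?_ h.bar_le) _
          refine lintegral_max_residualLaw_le hκ (by simpa using hle 0 le_rfl h.L_pos.le)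
            (hle l hl0 hlL) h.η_nonneg h.η_lt hmass ?_ ?_ ?_ hcond
          · rw [Measure.map_apply (by fun_prop) .univ, Set.preimage_univ, hmass]
          · refine measure_mono_null ?_
              (ae_iff.1 (ae_uniformPart (c := c) (L := L) (η := η)))
            intro y hy hcon
            have : c + L < y := hy
            linarith [hcon.2, h.L_pos]
          · rw [Measure.map_apply (by fun_prop) measurableSet_Ioi]
            refine measure_mono_null ?_
              (ae_iff.1 (ae_uniformPart (c := c) (L := L) (η := η)))
            intro y hy hcon
            have : c + L < y + l := hy
            linarith [hcon.2]
      _ = _ := by rw [← ENNReal.ofReal_mul hΦF]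
  have h1η : 0 ≤ 1 - η := by linarith [h.η_lt]
  have hv := h.v_nonneg (i - 1)
  have hη := h.η_nonneg
  have hF := h.F_nonneg
  have hlam := h.lam_nonneg
  have hε := h.ε_nonneg
  have hfm : Measurable fun y : ℝ × ℝ => ENNReal.ofReal (V (z.move R y)) :=
    ((measurable_pairPotential _ _ _ _ _ _).comp (measurable_pairMove_right R z)).ennreal_ofReal
  rw [hVz, hshift, hJ.lintegral_eq l hl0 hlL _ hfm, min_eq_left hlt.le]
  calc _ ≤ ENNReal.ofReal (Φ * (η * Real.exp (θ * β * c) * v (i - 1)))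
        + ENNReal.ofReal (1 - η) * ENNReal.ofReal (Φ * F * lam)
        + ENNReal.ofReal (ε * Real.exp (θ * β * dl * m)) := by gcongr
    _ = ENNReal.ofReal (Φ * (η * Real.exp (θ * β * c) * v (i - 1)) + (1 - η) * (Φ * F * lam)
        + ε * Real.exp (θ * β * dl * m)) := by
        rw [← ENNReal.ofReal_mul h1η, ← ENNReal.ofReal_add (by positivity) (by positivity),
          ← ENNReal.ofReal_add (by positivity) (by positivity)]
    _ ≤ _ := by
        refine ENNReal.ofReal_le_ofReal ?_
        have h1 : Real.exp (θ * β * dl * m) ≤ Φ :=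
          le_mul_of_one_le_right (Real.exp_pos _).le
            (Real.one_le_exp (mul_nonneg hκ (by linarith)))
        have h2 := mul_le_mul_of_nonneg_left (h.v_succ (i - 1)) hΦ0
        rw [hi1] at h2
        have h3 := mul_le_mul_of_nonneg_left h1 hε
        linarith

/-- The drift inequality for the Lyapunov function. -/
theorem drift (h : DriftParams μ β θ dl R c L η lam ε F r v) [IsProbabilityMeasure μ]
    (hμ : ∀ᵐ x ∂μ, 0 < x) (hcond : 0 < μ (Set.Ioi (c + L)))
    (hle : ∀ l, 0 ≤ l → l ≤ L → (uniformPart c L η).map (· + l) ≤ μ)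
    {J : Kernel ℝ (ℝ × ℝ)} (hJ : IsShiftCoupling μ (uniformPart c L η) L η J) (z : PairState) :
    ∫⁻ y, ENNReal.ofReal (V (z.move R y)) ∂(J (z.shift L))
      + (if z.1.1 = z.2.1.1 then 0
        else ENNReal.ofReal (ε * Real.exp (θ * β * dl * min z.1.1 z.2.1.1)))
      ≤ ENNReal.ofReal (V z) := by
  have hlt : ∀ z : PairState, z.1.1 < z.2.1.1 →
      ∫⁻ y, ENNReal.ofReal (V (z.move R y)) ∂(J (z.shift L))
        + ENNReal.ofReal (ε * Real.exp (θ * β * dl * min z.1.1 z.2.1.1))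
        ≤ ENNReal.ofReal (V z) := by
    intro z hz
    rcases lt_or_ge R (z.2.1.1 - z.1.1) with hg | hg
    · exact drift_of_gap_gt h hJ hg
    · exact drift_of_gap_le h hμ hcond hle hJ hz hg
  rcases lt_trichotomy z.1.1 z.2.1.1 with hz | hz | hz
  · rw [if_neg hz.ne]
    exact hlt z hz
  · rw [if_pos hz, add_zero]
    have hm : ∀ y, V (z.move R y) = V z := by
      intro y
      have h1 : (z.move R y).1.1 = (z.move R y).2.1.1 := by
        simp [PairState.move, Side.move, Side.advance, hz, h.R_nonneg.not_gt]
      have h2 : (z.move R y).2.2 = z.2.2 := by simp only [PairState.move, if_pos hz]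
      rw [pairPotential, pairPotential, if_pos h1, if_pos hz, h2]
    have := hJ.markov
    simp [hm]
  -- Exchanging the two sides reduces this case to the one already treated.
  · rw [if_neg hz.ne']
    have h1 := hlt z.swap hz
    simp only [PairState.move_swap, PairState.shift_swap, pairPotential_swap] at h1
    simpa only [PairState.swap, min_comm] using h1

end Drift

/-! ### Almost sure meeting and construction of the coupling -/

open Filter Topology in
/-- The partial sums of an i.i.d. sequence with positive mean diverge. -/
theorem tendsto_sum_atTop_of_iid {Ω : Type*} [MeasurableSpace Ω] {P : Measure Ω}
    {μ : Measure ℝ} [IsProbabilityMeasure μ] {X : ℕ → Ω → ℝ}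
    (hX : ∀ i, Measurable (X i)) (hlaw : ∀ i, P.map (X i) = μ) (hind : iIndepFun X P)
    (hint : Integrable id μ) (hpos : ∀ᵐ x ∂μ, 0 < x) :
    ∀ᵐ ω ∂P, Tendsto (fun n => ∑ i ∈ Finset.range n, X i ω) atTop atTop := by
  have hint0 : Integrable (X 0) P := by
    have := hint
    rw [← hlaw 0] at this
    exact this.comp_measurable (hX 0)
  have hmean : 0 < ∫ ω, X 0 ω ∂P := by
    have h1 : ∫ ω, X 0 ω ∂P = ∫ x, x ∂μ := by
      rw [← hlaw 0, integral_map (hX 0).aemeasurable (by fun_prop)]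
    rw [h1, integral_pos_iff_support_of_nonneg_ae (f := fun x : ℝ => x)
      (by filter_upwards [hpos] with x hx using hx.le) hint]
    have h2 : μ (Function.support fun x : ℝ => x) = 1 := by
      have h3 : (Function.support fun x : ℝ => x) =ᵐ[μ] Set.univ :=
        eventuallyEq_univ.2 (by filter_upwards [hpos] with x hx using hx.ne')
      rw [measure_congr h3, measure_univ]
    rw [h2]; exact one_pos
  have hslln := strong_law_ae_real X hint0 (fun i j hij => hind.indepFun hij)
    (fun i => ⟨(hX i).aemeasurable, (hX 0).aemeasurable, by rw [hlaw, hlaw]⟩)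
  filter_upwards [hslln] with ω hω
  have h1 := hω.pos_mul_atTop hmean (tendsto_natCast_atTop_atTop (R := ℝ))
  refine h1.congr' ?_
  filter_upwards [eventually_gt_atTop 0] with n hn
  have : (n : ℝ) ≠ 0 := by positivity
  field_simp

section Coupling

variable {μ : Measure ℝ} {R L c η : ℝ} {g : ℝ → unitInterval → ℝ × ℝ}
  {J : Kernel ℝ (ℝ × ℝ)} {z : PairState}

/-- The Lyapunov function decreases in mean along the chain. -/
theorem lintegral_pairPotential_add_le {β θ dl lam ε F r : ℝ} {v : ℕ → ℝ}
    (h : DriftParams μ β θ dl R c L η lam ε F r v) [IsProbabilityMeasure μ]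
    (hμ : ∀ᵐ x ∂μ, 0 < x) (hcond : 0 < μ (Set.Ioi (c + L)))
    (hle : ∀ l, 0 ≤ l → l ≤ L → (uniformPart c L η).map (· + l) ≤ μ)
    (hJ : IsShiftCoupling μ (uniformPart c L η) L η J) (hg : Measurable (Function.uncurry g))
    (hgJ : ∀ l, Measure.map (g l) volume = J l) (n : ℕ) :
    ∫⁻ ω, ENNReal.ofReal (pairPotential (θ * β) dl R L F v (pairChain R L g z (n + 1) ω)) ∂seedLaw
      + ∫⁻ ω, (if (pairChain R L g z n ω).1.1 = (pairChain R L g z n ω).2.1.1 then 0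
          else ENNReal.ofReal (ε * Real.exp (θ * β * dl * min (pairChain R L g z n ω).1.1
            (pairChain R L g z n ω).2.1.1))) ∂seedLaw
      ≤ ∫⁻ ω, ENNReal.ofReal (pairPotential (θ * β) dl R L F v (pairChain R L g z n ω))
        ∂seedLaw := by
  have hVm := (measurable_pairPotential (θ * β) dl R L F v).ennreal_ofReal
  have hcm := measurable_pairChain (R := R) (L := L) (z := z) hg n
  rw [lintegral_pairChain_succ hg hgJ n hVm, ← lintegral_add_right]
  · exact lintegral_mono fun ω => drift h hμ hcond hle hJ _
  · have : Measurable fun z : PairState => if z.1.1 = z.2.1.1 then (0 : ℝ≥0∞)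
        else ENNReal.ofReal (ε * Real.exp (θ * β * dl * min z.1.1 z.2.1.1)) :=
      Measurable.ite (measurableSet_eq_fun (by fun_prop) (by fun_prop)) measurable_const
        (by fun_prop)
    exact this.comp hcm

theorem lintegral_pairPotential_le {β θ dl lam ε F r : ℝ} {v : ℕ → ℝ}
    (h : DriftParams μ β θ dl R c L η lam ε F r v) [IsProbabilityMeasure μ]
    (hμ : ∀ᵐ x ∂μ, 0 < x) (hcond : 0 < μ (Set.Ioi (c + L)))
    (hle : ∀ l, 0 ≤ l → l ≤ L → (uniformPart c L η).map (· + l) ≤ μ)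
    (hJ : IsShiftCoupling μ (uniformPart c L η) L η J) (hg : Measurable (Function.uncurry g))
    (hgJ : ∀ l, Measure.map (g l) volume = J l) (n : ℕ) :
    ∫⁻ ω, ENNReal.ofReal (pairPotential (θ * β) dl R L F v (pairChain R L g z n ω)) ∂seedLaw
      ≤ ENNReal.ofReal (pairPotential (θ * β) dl R L F v z) := by
  induction n with
  | zero => simp [pairChain]
  | succ n ih =>
    exact (le_self_add.trans
      (lintegral_pairPotential_add_le h hμ hcond hle hJ hg hgJ n)).trans ih

theorem pairChain_succ_fst (n : ℕ) (ω : ℕ → unitInterval) :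
    (pairChain R L g z (n + 1) ω).1 = (pairChain R L g z n ω).1.move R (pairChain R L g z n ω).2.1
      (g ((pairChain R L g z n ω).shift L) (ω n)) := rfl

theorem pairChain_succ_snd (n : ℕ) (ω : ℕ → unitInterval) :
    (pairChain R L g z (n + 1) ω).2.1 = (pairChain R L g z n ω).2.1.move R
      (pairChain R L g z n ω).1 (g ((pairChain R L g z n ω).shift L) (ω n)) := rfl

/-- A strictly positive drift forces the two processes to meet. -/
theorem ae_exists_met {β θ lam ε F r : ℝ} {v : ℕ → ℝ} (hε : 0 < ε)
    (h : DriftParams μ β θ 0 R c L η lam ε F r v) [IsProbabilityMeasure μ]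
    (hμ : ∀ᵐ x ∂μ, 0 < x) (hcond : 0 < μ (Set.Ioi (c + L)))
    (hle : ∀ l, 0 ≤ l → l ≤ L → (uniformPart c L η).map (· + l) ≤ μ)
    (hJ : IsShiftCoupling μ (uniformPart c L η) L η J) (hg : Measurable (Function.uncurry g))
    (hgJ : ∀ l, Measure.map (g l) volume = J l) :
    ∀ᵐ ω ∂seedLaw, ∃ n, (pairChain R L g z n ω).1.1 = (pairChain R L g z n ω).2.1.1 := by
  set A : Set (ℕ → unitInterval) :=
    {ω | ¬ ∃ n, (pairChain R L g z n ω).1.1 = (pairChain R L g z n ω).2.1.1} with hA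
  -- Without time weight, every step on the event `A` of never meeting costs at least `ε`. Summing
  -- bounds `n * ε * seedLaw A` by the initial potential for all `n`.
  have hstep : ∀ n : ℕ,
      ∫⁻ ω, ENNReal.ofReal (pairPotential (θ * β) 0 R L F v (pairChain R L g z n ω)) ∂seedLaw
        + n * (ENNReal.ofReal ε * seedLaw A)
        ≤ ENNReal.ofReal (pairPotential (θ * β) 0 R L F v z) := by
    intro n
    induction n with
    | zero => simp [pairChain]
    | succ n ih =>
      have h1 := lintegral_pairPotential_add_le (z := z) h hμ hcond hle hJ hg hgJ n
      have h2 : ENNReal.ofReal ε * seedLaw A ≤ ∫⁻ ω, (if (pairChain R L g z n ω).1.1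
          = (pairChain R L g z n ω).2.1.1 then 0
          else ENNReal.ofReal (ε * Real.exp (θ * β * 0 * min (pairChain R L g z n ω).1.1
            (pairChain R L g z n ω).2.1.1))) ∂seedLaw := by
        have hAm : MeasurableSet A := by
          have : A = ⋂ n, {ω | (pairChain R L g z n ω).Met}ᶜ := by
            ext ω; simp [hA, PairState.Met]
          rw [this]
          exact MeasurableSet.iInter fun n =>
            ((measurable_pairChain hg n) measurableSet_met).compl
        calc ENNReal.ofReal ε * seedLaw A = ∫⁻ ω, A.indicator (fun _ => ENNReal.ofReal ε) ω
              ∂seedLaw := by rw [lintegral_indicator_const hAm]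
          _ ≤ _ := by
              refine lintegral_mono fun ω => ?_
              by_cases hω : ω ∈ A
              · rw [Set.indicator_of_mem hω, if_neg (fun hcon => hω ⟨n, hcon⟩)]
                simp
              · rw [Set.indicator_of_notMem hω]
                exact zero_le
      calc _ = ∫⁻ ω, ENNReal.ofReal (pairPotential (θ * β) 0 R L F v
              (pairChain R L g z (n + 1) ω)) ∂seedLaw
              + ENNReal.ofReal ε * seedLaw A + n * (ENNReal.ofReal ε * seedLaw A) := by
            push_cast; ring
        _ ≤ _ := (add_le_add_left (le_trans (add_le_add_right h2 _) h1) _).trans ih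
  have hzero : ENNReal.ofReal ε * seedLaw A = 0 := by
    by_contra hne
    obtain ⟨n, hn⟩ := ENNReal.exists_nat_mul_gt hne
      (ENNReal.ofReal_ne_top (r := pairPotential (θ * β) 0 R L F v z))
    exact absurd (le_add_self.trans (hstep n)) (not_le.2 hn)
  rw [ae_iff]
  rcases mul_eq_zero.1 hzero with h0 | h0
  · exact absurd (ENNReal.ofReal_eq_zero.1 h0) (not_le.2 hε)
  · exact h0

end Coupling

/-- The initial state of the coupling: one process starts at `x`, the other at `0`. -/
def initialPair (x : ℝ) : PairState := ((x, 0, 0), (0, 0, 0), x)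

/-- Given positive drift for the Lyapunov function without time weight, the coupling exists, and
every admissible Lyapunov function bounds the exponential moment of the coupling time. -/
theorem exists_coupling {μ : Measure ℝ} [IsProbabilityMeasure μ] (hμ : ∀ᵐ r ∂μ, 0 < r)
    (hint : Integrable id μ) {c L R η : ℝ} (hcond : 0 < μ (Set.Ioi (c + L)))
    (hle : ∀ l, 0 ≤ l → l ≤ L → (uniformPart c L η).map (· + l) ≤ μ)
    {β₀ θ₀ lam₀ ε₀ F₀ r₀ : ℝ} {v₀ : ℕ → ℝ} (hε₀ : 0 < ε₀)
    (h₀ : DriftParams μ β₀ θ₀ 0 R c L η lam₀ ε₀ F₀ r₀ v₀) {x : ℝ} (hx : 0 ≤ x) :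
    ∃ (Ω : Type) (_ : MeasurableSpace Ω) (P : Measure Ω) (_ : IsProbabilityMeasure P)
      (T T' : ℕ → Ω → ℝ) (τ : Ω → ℝ),
      IsRenewalProcess P μ x T ∧ IsRenewalProcess P μ 0 T' ∧ IsCouplingTime P T T' τ ∧
      ∀ (β θ dl lam ε F r : ℝ) (v : ℕ → ℝ), DriftParams μ β θ dl R c L η lam ε F r v →
        ∫⁻ ω, ENNReal.ofReal (Real.exp (θ * β * dl * τ ω)) ∂P
          ≤ ENNReal.ofReal (pairPotential (θ * β) dl R L F v (initialPair x)) := by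
  have hR := h₀.R_nonneg
  obtain ⟨J, hJm, hJ1, hJ2, hJl⟩ := exists_shift_coupling μ (uniformPart c L η) h₀.L_pos.le
    h₀.η_nonneg h₀.η_lt (uniformPart_univ h₀.L_pos) hle
  have hJ : IsShiftCoupling μ (uniformPart c L η) L η J := ⟨hJm, hJ1, hJ2, hJl⟩
  -- The state-dependent coupling becomes a measurable function of one uniform seed per step, so the
  -- whole chain lives on a product space.
  obtain ⟨g, hg, hgJ⟩ := Kernel.exists_measurable_map_eq_unitInterval J
  let Z : ℕ → (ℕ → unitInterval) → PairState := pairChain R L g (initialPair x)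
  have hZm : ∀ n, Measurable (Z n) := measurable_pairChain hg
  let s : ℕ → (ℕ → unitInterval) → Side := fun n ω => (Z n ω).1
  let o : ℕ → (ℕ → unitInterval) → Side := fun n ω => (Z n ω).2.1
  let y : ℕ → (ℕ → unitInterval) → ℝ × ℝ := fun n ω => g ((Z n ω).shift L) (ω n)
  have hsm : ∀ n, Measurable (s n) := fun n => (hZm n).fst
  have hom : ∀ n, Measurable (o n) := fun n => (hZm n).snd.fst
  have hs : ∀ n ω, s (n + 1) ω = (s n ω).move R (o n ω) (y n ω) := pairChain_succ_fst
  have ho : ∀ n ω, o (n + 1) ω = (o n ω).move R (s n ω) (y n ω) := pairChain_succ_snd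
  have hmet : ∀ᵐ ω ∂seedLaw, ∃ n, (s n ω).1 = (o n ω).1 :=
    ae_exists_met hε₀ h₀ hμ hcond hle hJ hg hgJ
  have hmet' : ∀ᵐ ω ∂seedLaw, ∃ n, (o n ω).1 = (s n ω).1 := by
    filter_upwards [hmet] with ω ⟨n, hn⟩ using ⟨n, hn.symm⟩
  let X : ℕ → (ℕ → unitInterval) → ℝ :=
    fun i ω => sideIncrement (fun n => s n ω) (fun n => o n ω) i
  let X' : ℕ → (ℕ → unitInterval) → ℝ :=
    fun i ω => sideIncrement (fun n => o n ω) (fun n => s n ω) i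
  have hXm : ∀ i, Measurable (X i) := measurable_sideIncrement hsm hom
  have hXm' : ∀ i, Measurable (X' i) := measurable_sideIncrement hom hsm
  have hJp : ∀ l, IsProbabilityMeasure (J l) := fun l => hJm.isProbabilityMeasure l
  obtain ⟨hlaw, hind⟩ : (∀ i, seedLaw.map (X i) = μ) ∧ iIndepFun X seedLaw := by
    refine iid_sideIncrement hR hsm hom hs ho (fun _ => rfl) (fun m B hB n => ?_) hmet
    refine (lintegral_pairChain_succ hg hgJ n (f := fun z => sideWeight μ B m z.1)
      ((measurable_sideWeight hB).comp measurable_fst)).trans (lintegral_congr fun ω => ?_)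
    exact lintegral_sideWeight_move hB (hJ1 _) (hJ2 _) R _ _
  obtain ⟨hlaw', hind'⟩ : (∀ i, seedLaw.map (X' i) = μ) ∧ iIndepFun X' seedLaw := by
    refine iid_sideIncrement hR hom hsm ho hs (fun _ => rfl) (fun m B hB n => ?_) hmet'
    refine (lintegral_pairChain_succ hg hgJ n (f := fun z => sideWeight μ B m z.2.1)
      ((measurable_sideWeight hB).comp measurable_snd.fst)).trans (lintegral_congr fun ω => ?_)
    exact lintegral_sideWeight_move hB (hJ1 _) (hJ2 _) R _ _
  have hXpos : ∀ᵐ ω ∂seedLaw, ∀ i, 0 < X i ω := ae_all_iff.2 fun i =>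
    ae_of_ae_map (hXm i).aemeasurable (p := fun u => 0 < u) (by rwa [hlaw i])
  have hXpos' : ∀ᵐ ω ∂seedLaw, ∀ i, 0 < X' i ω := ae_all_iff.2 fun i =>
    ae_of_ae_map (hXm' i).aemeasurable (p := fun u => 0 < u) (by rwa [hlaw' i])
  let T : ℕ → (ℕ → unitInterval) → ℝ := fun n ω => x + ∑ i ∈ Finset.range n, X i ω
  let T' : ℕ → (ℕ → unitInterval) → ℝ := fun n ω => 0 + ∑ i ∈ Finset.range n, X' i ω
  have hT : ∀ n, (fun ω => T (n + 1) ω - T n ω) = X n := fun n => by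
    funext ω; simp [T, Finset.sum_range_succ]
  have hT' : ∀ n, (fun ω => T' (n + 1) ω - T' n ω) = X' n := fun n => by
    funext ω; simp [T', Finset.sum_range_succ]
  have hren : IsRenewalProcess seedLaw μ x T :=
    { measurable := fun n =>
        measurable_const.add (Finset.measurable_sum _ fun i _ => hXm i)
      delay := Filter.Eventually.of_forall fun ω => by simp [T]
      law := fun n => by rw [hT, hlaw]
      indep := by
        rw [show (fun n ω => T (n + 1) ω - T n ω) = X from funext hT]
        exact hind }
  have hren' : IsRenewalProcess seedLaw μ 0 T' :=
    { measurable := fun n =>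
        measurable_const.add (Finset.measurable_sum _ fun i _ => hXm' i)
      delay := Filter.Eventually.of_forall fun ω => by simp [T']
      law := fun n => by rw [hT', hlaw']
      indep := by
        rw [show (fun n ω => T' (n + 1) ω - T' n ω) = X' from funext hT']
        exact hind' }
  let p : (ℕ → unitInterval) → ℕ := fun ω => meetIndex (fun n => s n ω) (fun n => o n ω)
  have hpm : Measurable p := measurable_meetIndex hsm hom
  let t : ℕ → (ℕ → unitInterval) → ℝ := fun n ω => (Z n ω).2.2
  have htm : ∀ n, Measurable (t n) := fun n => (hZm n).snd.snd
  -- The maximum matters only on a null set; it makes the time nonnegative at every `ω`.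
  let τ : (ℕ → unitInterval) → ℝ := fun ω => max 0 (t (p ω) ω)
  have hτm : Measurable τ := by
    have h1 : Measurable fun q : ℕ × (ℕ → unitInterval) => t q.1 q.2 :=
      measurable_from_prod_countable_right htm
    exact measurable_const.max (h1.comp (hpm.prodMk measurable_id))
  have htp : ∀ ω, (∃ n, (s n ω).1 = (o n ω).1) → t (p ω) ω = (s (p ω) ω).1 := by
    intro ω hω
    have hp : (s (p ω) ω).1 = (o (p ω) ω).1 := Nat.sInf_mem hω
    -- At index 0 the recorded epoch is the initial `x`. Otherwise the preceding step was unmet and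
    -- recorded the later epoch, which is the common one.
    rcases hcase : p ω with _ | n
    · rfl
    · have hn : ¬ (s n ω).1 = (o n ω).1 := fun hcon => by
        have : p ω ≤ n := Nat.sInf_le hcon
        omega
      rw [hcase] at hp
      have : t (n + 1) ω = max (s (n + 1) ω).1 (o (n + 1) ω).1 := if_neg hn
      rw [this, hp, max_self]
  have htconst : ∀ ω, (∃ n, (s n ω).1 = (o n ω).1) → ∀ n, p ω ≤ n → t n ω = t (p ω) ω := by
    intro ω hω n hn
    have hp : (s (p ω) ω).1 = (o (p ω) ω).1 := Nat.sInf_mem hω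
    induction n, hn using Nat.le_induction with
    | base => rfl
    | succ n hn ih =>
      have hmn : (s n ω).1 = (o n ω).1 :=
        met_of_le (s := fun n => s n ω) (o := fun n => o n ω) hR (fun n => hs n ω)
          (fun n => ho n ω) hn hp
      have : t (n + 1) ω = t n ω := if_pos hmn
      rw [this, ih]
  have hpos : ∀ ω, (∃ n, (s n ω).1 = (o n ω).1) → ∀ n,
      (s n ω).1 = T (s n ω).2.1 ω := fun ω hω =>
    position_eq_sum_sideIncrement (s := fun n => s n ω) (o := fun n => o n ω) hR
      (fun n => hs n ω) (fun n => ho n ω) rfl rfl hω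
  have hpos' : ∀ ω, (∃ n, (o n ω).1 = (s n ω).1) → ∀ n,
      (o n ω).1 = T' (o n ω).2.1 ω := fun ω hω =>
    position_eq_sum_sideIncrement (s := fun n => o n ω) (o := fun n => s n ω) hR
      (fun n => ho n ω) (fun n => hs n ω) rfl rfl hω
  have hτ : ∀ᵐ ω ∂seedLaw, τ ω = t (p ω) ω := by
    filter_upwards [hmet, hXpos] with ω hω hX
    refine max_eq_right ?_
    rw [htp ω hω, hpos ω hω]
    exact add_nonneg hx (Finset.sum_nonneg fun i _ => (hX i).le)
  refine ⟨ℕ → unitInterval, inferInstance, seedLaw, inferInstance, T, T', τ, hren, hren',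
    ⟨hτm, fun ω => le_max_left _ _, ?_⟩, ?_⟩
  · filter_upwards [hmet, hmet', hXpos, hXpos',
      tendsto_sum_atTop_of_iid hXm hlaw hind hint hμ] with ω hω hω' hX hX' hlim u hu
    have hp : (s (p ω) ω).1 = (o (p ω) ω).1 := Nat.sInf_mem hω
    refine residualLife_eq_of_agree (p := (s (p ω) ω).2.1) (q := (o (p ω) ω).2.1) ?_ ?_
      (Filter.tendsto_atTop_add_const_left _ _ hlim) (fun j => ?_) ?_
    · exact monotone_nat_of_le_succ fun n => by
        simp only [Finset.sum_range_succ]; linarith [hX n]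
    · exact monotone_nat_of_le_succ fun n => by
        simp only [T', Finset.sum_range_succ]; linarith [hX' n]
    · have h1 : (s (p ω + j) ω).2.1 = (s (p ω) ω).2.1 + j :=
        count_of_met (s := fun n => s n ω) (o := fun n => o n ω) hR (fun n => hs n ω)
          (fun n => ho n ω) hp j
      have h2 : (o (p ω + j) ω).2.1 = (o (p ω) ω).2.1 + j :=
        count_of_met (s := fun n => o n ω) (o := fun n => s n ω) hR (fun n => ho n ω)
          (fun n => hs n ω) hp.symm j
      have h3 : (s (p ω + j) ω).1 = (o (p ω + j) ω).1 :=
        met_of_le (s := fun n => s n ω) (o := fun n => o n ω) hR (fun n => hs n ω)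
          (fun n => ho n ω) (Nat.le_add_right _ j) hp
      change T _ ω = T' _ ω
      rw [← h1, ← h2, ← hpos ω hω, ← hpos' ω hω', h3]
    · change T _ ω ≤ u
      rw [← hpos ω hω, ← htp ω hω]
      exact (le_max_right _ _).trans hu
  · intro β θ dl lam ε F r v h
    have hVm := (measurable_pairPotential (θ * β) dl R L F v).ennreal_ofReal
    -- Along almost every path the potential is eventually constant with value `exp (θ * β * dl *
    -- τ)`; Fatou's lemma carries the supermartingale bound over.
    calc ∫⁻ ω, ENNReal.ofReal (Real.exp (θ * β * dl * τ ω)) ∂seedLaw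
        ≤ ∫⁻ ω, Filter.liminf (fun n => ENNReal.ofReal
            (pairPotential (θ * β) dl R L F v (Z n ω))) Filter.atTop ∂seedLaw := by
          refine lintegral_mono_ae ?_
          filter_upwards [hmet, hτ] with ω hω hτω
          have hp : (s (p ω) ω).1 = (o (p ω) ω).1 := Nat.sInf_mem hω
          have hev : ∀ᶠ n in Filter.atTop, ENNReal.ofReal (Real.exp (θ * β * dl * τ ω)) =
              ENNReal.ofReal (pairPotential (θ * β) dl R L F v (Z n ω)) := by
            filter_upwards [Filter.eventually_ge_atTop (p ω)] with n hn
            have hmn : (s n ω).1 = (o n ω).1 :=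
              met_of_le (s := fun n => s n ω) (o := fun n => o n ω) hR (fun n => hs n ω)
                (fun n => ho n ω) hn hp
            rw [hτω, ← htconst ω hω n hn, pairPotential, if_pos hmn]
          exact (Filter.Tendsto.liminf_eq (tendsto_const_nhds.congr' hev)).ge
      _ ≤ Filter.liminf (fun n => ∫⁻ ω, ENNReal.ofReal
            (pairPotential (θ * β) dl R L F v (Z n ω)) ∂seedLaw) Filter.atTop :=
          lintegral_liminf_le fun n => hVm.comp (hZm n)
      _ ≤ _ := by
          refine Filter.liminf_le_of_le (by isBoundedDefault) fun b hb => ?_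
          obtain ⟨n, hn⟩ := hb.exists
          exact hn.trans (lintegral_pairPotential_le h hμ hcond hle hJ hg hgJ n)

/-! ### Laplace transforms and the critical radius -/

/-- Jensen's inequality for a concave power, read off from the monotonicity of Lᵖ norms on a
probability space. -/
theorem lintegral_rpow_le_rpow_lintegral {Ω : Type*} [MeasurableSpace Ω] {P : Measure Ω}
    [IsProbabilityMeasure P] {f : Ω → ℝ≥0∞} (hf : Measurable f) {p : ℝ} (hp : 0 < p)
    (hp1 : p ≤ 1) : ∫⁻ ω, f ω ^ p ∂P ≤ (∫⁻ ω, f ω ∂P) ^ p := by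
  have h := eLpNorm'_le_eLpNorm'_of_exponent_le hp hp1 P hf.aestronglyMeasurable
  simp only [eLpNorm', enorm_eq_self, ENNReal.rpow_one, div_one] at h
  calc ∫⁻ ω, f ω ^ p ∂P = ((∫⁻ ω, f ω ^ p ∂P) ^ (1 / p)) ^ p := by
        rw [← ENNReal.rpow_mul, one_div_mul_cancel hp.ne', ENNReal.rpow_one]
    _ ≤ _ := ENNReal.rpow_le_rpow h hp.le

section Laplace

variable {μ : Measure ℝ}

theorem laplace_zero [IsProbabilityMeasure μ] : laplace μ 0 = 1 := by simp [laplace]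

theorem laplace_mono (hμ : ∀ᵐ r ∂μ, 0 < r) {s s' : ℝ} (h : s ≤ s') :
    laplace μ s ≤ laplace μ s' := by
  refine lintegral_mono_ae ?_
  filter_upwards [hμ] with r hr
  exact ENNReal.ofReal_le_ofReal (Real.exp_le_exp.2 (mul_le_mul_of_nonneg_right h hr.le))

theorem laplace_strictMono [IsProbabilityMeasure μ] (hμ : ∀ᵐ r ∂μ, 0 < r) {s s' : ℝ} (h : s < s')
    (hs : laplace μ s ≠ ∞) : laplace μ s < laplace μ s' := by
  refine lintegral_strict_mono (IsProbabilityMeasure.ne_zero μ) (by fun_prop) hs ?_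
  filter_upwards [hμ] with r hr
  exact (ENNReal.ofReal_lt_ofReal_iff (Real.exp_pos _)).2
    (Real.exp_lt_exp.2 (mul_lt_mul_of_pos_right h hr))

theorem laplace_rpow_le [IsProbabilityMeasure μ] {θ s : ℝ} (hθ : 0 < θ) (hθ1 : θ ≤ 1) :
    laplace μ (θ * s) ≤ laplace μ s ^ θ := by
  refine le_trans (le_of_eq ?_) (lintegral_rpow_le_rpow_lintegral
    (f := fun r : ℝ => ENNReal.ofReal (Real.exp (s * r))) (by fun_prop) hθ hθ1)
  refine lintegral_congr fun r => ?_
  rw [ENNReal.ofReal_rpow_of_pos (Real.exp_pos _), ← Real.exp_mul]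
  congr 2; ring

theorem integrable_id_of_hasExpMoment (hμ : ∀ᵐ r ∂μ, 0 < r) (h : HasExpMoment μ) :
    Integrable id μ := by
  obtain ⟨α, hα, hfin⟩ := h
  have h1 : Integrable (fun r => Real.exp (α * r)) μ := by
    refine ⟨by fun_prop, ?_⟩
    rw [hasFiniteIntegral_iff_ofReal (Filter.Eventually.of_forall fun r => (Real.exp_pos _).le)]
    exact hfin
  refine (h1.div_const α).mono' (by fun_prop) ?_
  filter_upwards [hμ] with r hr
  rw [id, Real.norm_of_nonneg hr.le, le_div_iff₀ hα]
  linarith [Real.add_one_le_exp (α * r)]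

theorem isProbabilityMeasure_condMaxLaw [IsProbabilityMeasure μ] {a : ℝ}
    (ha : 0 < μ (Set.Ioi a)) : IsProbabilityMeasure (condMaxLaw μ a) := by
  have := cond_isProbabilityMeasure ha.ne'
  exact Measure.isProbabilityMeasure_map (by fun_prop)

theorem laplaceBar_eq [IsProbabilityMeasure μ] {a : ℝ} (ha : 0 < μ (Set.Ioi a)) (s : ℝ) :
    laplaceBar μ a s = ∫⁻ y₁, ∫⁻ y₂, ENNReal.ofReal (Real.exp (s * max y₁ y₂))
      ∂(cond μ (Set.Ioi a)) ∂(cond μ (Set.Ioi a)) := by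
  have hc : IsProbabilityMeasure (cond μ (Set.Ioi a)) := cond_isProbabilityMeasure ha.ne'
  rw [laplaceBar, laplace, condMaxLaw, lintegral_map (by fun_prop) (by fun_prop),
    lintegral_prod _ (by fun_prop)]

/-- The conditioned variables exceed `a`. With `a = c + L` this shows that a failure factor is never
smaller than the success factor `exp (θ * β * c)`. -/
theorem exp_le_laplaceBar [IsProbabilityMeasure μ] {a s : ℝ} (ha : 0 < μ (Set.Ioi a))
    (hs : 0 ≤ s) : ENNReal.ofReal (Real.exp (s * a)) ≤ laplaceBar μ a s := by
  have hc : IsProbabilityMeasure (cond μ (Set.Ioi a)) := cond_isProbabilityMeasure ha.ne'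
  have hmem : ∀ᵐ y ∂(cond μ (Set.Ioi a)), y ∈ Set.Ioi a := by
    rw [ProbabilityTheory.cond]
    exact Measure.ae_smul_measure (ae_restrict_mem measurableSet_Ioi) _
  rw [laplaceBar_eq ha]
  calc _ = ∫⁻ _, ∫⁻ _, ENNReal.ofReal (Real.exp (s * a))
      ∂(cond μ (Set.Ioi a)) ∂(cond μ (Set.Ioi a)) := by simp
    _ ≤ _ := by
      refine lintegral_mono_ae ?_
      filter_upwards [hmem] with y hy
      refine lintegral_mono fun z => ENNReal.ofReal_le_ofReal (Real.exp_le_exp.2 ?_)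
      exact mul_le_mul_of_nonneg_left ((le_of_lt hy).trans (le_max_left _ _)) hs

/-- The exponential of a maximum is at most the sum of the two exponentials, and conditioning costs
only the factor `(μ (Set.Ioi a))⁻¹`. -/
theorem laplaceBar_ne_top [IsProbabilityMeasure μ] {a s : ℝ} (ha : 0 < μ (Set.Ioi a))
    (hfin : laplace μ s ≠ ∞) : laplaceBar μ a s ≠ ∞ := by
  have hc : IsProbabilityMeasure (cond μ (Set.Ioi a)) := cond_isProbabilityMeasure ha.ne'
  have hcond : laplace (cond μ (Set.Ioi a)) s ≠ ∞ := by
    rw [laplace, ProbabilityTheory.cond, lintegral_smul_measure]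
    refine ENNReal.mul_ne_top (ENNReal.inv_ne_top.2 ha.ne') ?_
    exact ne_top_of_le_ne_top hfin (lintegral_mono' Measure.restrict_le_self le_rfl)
  have hle : laplaceBar μ a s ≤ laplace (cond μ (Set.Ioi a)) s + laplace (cond μ (Set.Ioi a)) s := by
    rw [laplaceBar_eq ha]
    calc _ ≤ ∫⁻ y₁, ∫⁻ y₂, (ENNReal.ofReal (Real.exp (s * y₁))
          + ENNReal.ofReal (Real.exp (s * y₂))) ∂(cond μ (Set.Ioi a)) ∂(cond μ (Set.Ioi a)) := by
          refine lintegral_mono fun y₁ => lintegral_mono fun y₂ => ?_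
          rcases le_total y₁ y₂ with h | h
          · rw [max_eq_right h]; exact le_add_self
          · rw [max_eq_left h]; exact le_self_add
      _ = _ := by
          have h1 : ∀ y₁, ∫⁻ y₂, (ENNReal.ofReal (Real.exp (s * y₁))
              + ENNReal.ofReal (Real.exp (s * y₂))) ∂(cond μ (Set.Ioi a))
              = ENNReal.ofReal (Real.exp (s * y₁)) + laplace (cond μ (Set.Ioi a)) s := fun y₁ => by
            rw [lintegral_add_left measurable_const]; simp [laplace]
          simp_rw [h1]
          rw [lintegral_add_right _ measurable_const]; simp [laplace]
  exact ne_top_of_le_ne_top (ENNReal.add_ne_top.2 ⟨hcond, hcond⟩) hle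

/-- The mean effect of a move of the laggard, for gaps larger than `R`. -/
theorem lintegral_jump_le {β dl R D : ℝ} (hβ : 0 ≤ β) (hD : R < D)
    (ha : laplace μ ((1 + dl) * β) ≠ ∞) (hb : laplace μ (-((1 - dl) * β)) ≠ ∞) :
    ∫⁻ X, ENNReal.ofReal (Real.exp ((1 + dl) * β * X - 2 * β * D)
      + Real.exp (-((1 - dl) * β * X))) ∂μ
    ≤ ENNReal.ofReal (Real.exp (-(2 * β * R)) * (laplace μ ((1 + dl) * β)).toReal
        + (laplace μ (-((1 - dl) * β))).toReal) := by
  rw [ENNReal.ofReal_add (by positivity) ENNReal.toReal_nonneg,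
    ENNReal.ofReal_mul (Real.exp_pos _).le, ENNReal.ofReal_toReal ha, ENNReal.ofReal_toReal hb,
    laplace, laplace, ← lintegral_const_mul _ (by fun_prop), ← lintegral_add_left (by fun_prop)]
  refine lintegral_mono fun X => ?_
  rw [← ENNReal.ofReal_mul (Real.exp_pos _).le, ← Real.exp_add,
    ← ENNReal.ofReal_add (Real.exp_pos _).le (Real.exp_pos _).le]
  refine ENNReal.ofReal_le_ofReal (add_le_add (Real.exp_le_exp.2 ?_) (Real.exp_le_exp.2 ?_))
  · have : 2 * β * R ≤ 2 * β * D := mul_le_mul_of_nonneg_left hD.le (by positivity)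
    linarith
  · exact le_of_eq (by ring)

/-- The defining equation of the critical radius. -/
theorem criticalRadius_spec [IsProbabilityMeasure μ] (hμ : ∀ᵐ r ∂μ, 0 < r) {β δ : ℝ}
    (hβ : 0 < β) (hδ0 : 0 ≤ δ) (hδ1 : δ < 1) (hfin : laplace μ ((1 + δ) * β) ≠ ∞) :
    0 < criticalRadius μ δ β ∧ laplace μ (-((1 - δ) * β)) ≠ ∞ ∧
      Real.exp (-(2 * β * criticalRadius μ δ β)) * (laplace μ ((1 + δ) * β)).toReal
        + (laplace μ (-((1 - δ) * β))).toReal = 1 := by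
  have hneg : -((1 - δ) * β) < 0 := neg_lt_zero.2 (mul_pos (by linarith) hβ)
  have hb_le : laplace μ (-((1 - δ) * β)) ≤ 1 := laplace_zero (μ := μ) ▸ laplace_mono hμ hneg.le
  have hb_ne : laplace μ (-((1 - δ) * β)) ≠ ∞ := ne_top_of_le_ne_top ENNReal.one_ne_top hb_le
  have hb_lt : (laplace μ (-((1 - δ) * β))).toReal < 1 := by
    have h1 := laplace_strictMono hμ hneg hb_ne
    rw [laplace_zero] at h1
    exact ENNReal.toReal_lt_of_lt_ofReal (by simpa using h1)
  have hb_pos : 0 < (laplace μ (-((1 - δ) * β))).toReal := by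
    refine ENNReal.toReal_pos ?_ hb_ne
    rw [laplace, ne_eq, lintegral_eq_zero_iff (by fun_prop)]
    intro h
    have : ∀ᵐ _ ∂μ, False := by
      filter_upwards [h] with r hr
      exact (ENNReal.ofReal_pos.2 (Real.exp_pos _)).ne' hr
    rw [ae_iff] at this
    simp at this
  have ha : 1 ≤ (laplace μ ((1 + δ) * β)).toReal := by
    have h1 := laplace_mono hμ (show 0 ≤ (1 + δ) * β by positivity)
    rw [laplace_zero] at h1
    simpa using ENNReal.toReal_mono hfin h1
  set a := (laplace μ ((1 + δ) * β)).toReal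
  set b := (laplace μ (-((1 - δ) * β))).toReal
  have hq : 1 < a / (1 - b) := by rw [lt_div_iff₀ (by linarith)]; linarith
  have hR : 2 * β * criticalRadius μ δ β = Real.log (a / (1 - b)) := by
    change 2 * β * (1 / (2 * β) * Real.log (a / (1 - b))) = _
    field_simp
  refine ⟨mul_pos (by positivity) (Real.log_pos hq), hb_ne, ?_⟩
  rw [hR, Real.exp_neg, Real.exp_log (by linarith), inv_div]
  have : a ≠ 0 := by linarith
  field_simp
  ring

end Laplace

/-! ### Choice of the parameters and the tail bound -/

/-- The cost of a coupling attempt with `i` steps to go. -/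
noncomputable def attemptCost (η κc lam F ε : ℝ) : ℕ → ℝ
  | 0 => 1
  | i + 1 => (1 - η) * lam * F + η * Real.exp κc * attemptCost η κc lam F ε i + ε

/-- Unrolling `i + 1` steps yields only `i` factors `exp κc`, since the one next to `attemptCost … 0
= 1` is absorbed in `lam`. Hence a floor, not a ceiling, multiplies `c` in the final bound. -/
theorem attemptCost_succ_le {η κc lam F ε : ℝ} (hη0 : 0 ≤ η) (hη1 : η ≤ 1) (hκc : 0 ≤ κc)
    (hlam : Real.exp κc ≤ lam) (hF : 0 ≤ F) (hε : 0 ≤ ε) (i : ℕ) :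
    attemptCost η κc lam F ε (i + 1) ≤
      lam * Real.exp (κc * i) * (F * (1 - η ^ (i + 1)) + η ^ (i + 1) + (i + 1) * ε) := by
  have hlam1 : 1 ≤ lam := (Real.one_le_exp hκc).trans hlam
  induction i with
  | zero =>
    simp only [attemptCost, Nat.cast_zero, mul_zero, Real.exp_zero, mul_one, zero_add, pow_one,
      one_mul]
    have h1 := mul_le_mul_of_nonneg_left hlam hη0
    have h2 := le_mul_of_one_le_left hε hlam1
    linarith
  | succ i ih =>
    rw [attemptCost]
    have he : Real.exp (κc * (i + 1 : ℕ)) = Real.exp κc * Real.exp (κc * i) := by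
      rw [← Real.exp_add]; push_cast; congr 1; ring
    have h0 : 0 ≤ η * Real.exp κc := by positivity
    have h1 := mul_le_mul_of_nonneg_left ih h0
    have hE : 1 ≤ Real.exp κc * Real.exp (κc * i) := by
      rw [← he]; exact Real.one_le_exp (by positivity)
    have hlamE : lam ≤ lam * (Real.exp κc * Real.exp (κc * i)) :=
      le_mul_of_one_le_right (by linarith) hE
    have h2 : (1 - η) * F * lam ≤ (1 - η) * F * (lam * (Real.exp κc * Real.exp (κc * i))) :=
      mul_le_mul_of_nonneg_left hlamE (mul_nonneg (by linarith) hF)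
    have h3 : ε ≤ ε * (lam * (Real.exp κc * Real.exp (κc * i))) :=
      le_mul_of_one_le_right hε (hlam1.trans hlamE)
    have h4 : 0 ≤ (1 - η) * ((i + 1) * ε) * (lam * (Real.exp κc * Real.exp (κc * i))) := by
      have : 0 ≤ 1 - η := by linarith
      have : 0 ≤ lam := by linarith
      positivity
    rw [he]
    push_cast
    calc _ ≤ (1 - η) * F * (lam * (Real.exp κc * Real.exp (κc * i)))
          + η * Real.exp κc * (lam * Real.exp (κc * i) *
            (F * (1 - η ^ (i + 1)) + η ^ (i + 1) + (i + 1) * ε))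
          + ε * (lam * (Real.exp κc * Real.exp (κc * i))) := by linarith
      _ ≤ _ := by
          rw [← sub_nonneg]
          refine h4.trans (le_of_eq ?_)
          ring

/-- Clearing the denominator leaves `1 ≤ A * (1 + e)`. -/
theorem one_le_cycleCost {A q e : ℝ} (hA : 1 ≤ A) (he : 0 ≤ e) (h : A * (1 - q) < 1) :
    1 ≤ A * (q + e) / (1 - A * (1 - q)) := by
  rw [le_div_iff₀ (by linarith)]
  have := mul_nonneg (zero_le_one.trans hA) he
  linarith

/-- The parameters of the Lyapunov function, with the cost of a cycle in closed form. -/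
theorem exists_driftParams {μ : Measure ℝ} [IsProbabilityMeasure μ]
    {β θ dl R c L η lam ε ρ : ℝ} (hcond : 0 < μ (Set.Ioi (c + L)))
    (hβ : 0 ≤ β) (hθ : 0 < θ) (hθ1 : θ ≤ 1) (hdl0 : 0 ≤ dl) (hdl1 : dl ≤ 1) (hR : 0 ≤ R)
    (hL : 0 < L) (hLc : L ≤ c) (hη0 : 0 ≤ η) (hη1 : η < 1)
    (hbar : laplaceBar μ (c + L) (θ * β) ≤ ENNReal.ofReal lam)
    (hA : Real.exp (θ * β * (R + ⌊R / L⌋₊ * c)) * lam * (1 - η ^ ⌈R / L⌉₊) < 1)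
    (hρ0 : 0 ≤ ρ)
    (hjump : ∀ D, R < D → ∫⁻ X, ENNReal.ofReal (Real.exp ((1 + dl) * β * X - 2 * β * D)
      + Real.exp (-((1 - dl) * β * X))) ∂μ ≤ ENNReal.ofReal ρ)
    (hε : 0 ≤ ε) (hslack : ρ ^ (θ / 2) + ε ≤ 1) :
    ∃ F v, F = Real.exp (θ * β * (R + ⌊R / L⌋₊ * c)) * lam * (η ^ ⌈R / L⌉₊ + ⌈R / L⌉₊ * ε)
        / (1 - Real.exp (θ * β * (R + ⌊R / L⌋₊ * c)) * lam * (1 - η ^ ⌈R / L⌉₊)) ∧ 1 ≤ F ∧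
      DriftParams μ β θ dl R c L η lam ε F (ρ ^ (θ / 2)) v := by
  have hκ : 0 ≤ θ * β := mul_nonneg hθ.le hβ
  have hc : 0 ≤ c := hL.le.trans hLc
  have hlam : Real.exp (θ * β * c) ≤ lam := by
    have h1 := (exp_le_laplaceBar hcond hκ).trans hbar
    have h2 : Real.exp (θ * β * (c + L)) ≤ lam := by
      by_contra hcon
      exact absurd h1 (not_le.2 ((ENNReal.ofReal_lt_ofReal_iff (Real.exp_pos _)).2
        (not_le.1 hcon)))
    exact (Real.exp_le_exp.2 (mul_le_mul_of_nonneg_left (by linarith) hκ)).trans h2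
  have hκc : 0 ≤ θ * β * c := mul_nonneg hκ hc
  have hlam1 : 1 ≤ lam := (Real.one_le_exp hκc).trans hlam
  set k := ⌈R / L⌉₊ with hk
  set E := Real.exp (θ * β * (R + ⌊R / L⌋₊ * c)) with hE
  have hexpR : Real.exp (θ * β * R) * Real.exp (θ * β * c * ⌊R / L⌋₊) = E := by
    rw [← Real.exp_add, hE]; congr 1; ring
  have hE1 : 1 ≤ E := Real.one_le_exp (mul_nonneg hκ (by positivity))
  have hElam : 1 ≤ E * lam := one_le_mul_of_one_le_of_one_le hE1 hlam1
  set q := η ^ k with hq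
  have hkε : 0 ≤ (k : ℝ) * ε := by positivity
  set F := E * lam * (q + k * ε) / (1 - E * lam * (1 - q)) with hF
  have hF1 : 1 ≤ F := one_le_cycleCost hElam hkε hA
  -- `F` is the fixed point of the cycle: with weight `q` all attempts succeed, and with weight `1 -
  -- q` a new cycle of cost `F` begins.
  have hFeq : E * lam * (F * (1 - q) + q + k * ε) = F := by
    have hne : 1 - E * lam * (1 - q) ≠ 0 := by linarith
    have : F * (1 - E * lam * (1 - q)) = E * lam * (q + k * ε) := div_mul_cancel₀ _ hne
    linarith
  have hF0 : 0 ≤ F := by linarith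
  have hv0 : ∀ i, 0 ≤ attemptCost η (θ * β * c) lam F ε i := by
    intro i
    induction i with
    | zero => simp [attemptCost]
    | succ i ih =>
      rw [attemptCost]
      have : 0 ≤ 1 - η := by linarith
      have : 0 ≤ lam := by linarith
      positivity
  refine ⟨F, attemptCost η (θ * β * c) lam F ε, rfl, hF1, ?_⟩
  refine
    { β_nonneg := hβ
      θ_nonneg := hθ.le
      dl_nonneg := hdl0
      dl_le := hdl1
      R_nonneg := hR
      L_pos := hL
      L_le := hLc
      η_nonneg := hη0
      η_lt := hη1
      lam_nonneg := by linarith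
      ε_nonneg := hε
      F_nonneg := hF0
      v_zero := rfl
      v_nonneg := hv0
      v_succ := fun i => le_rfl
      v_le := ?_
      bar_le := hbar
      r_nonneg := Real.rpow_nonneg hρ0 _
      jump := ?_
      jump_slack := ?_ }
  · intro i hi
    have hERle : Real.exp (θ * β * R) ≤ E := by
      rw [← hexpR]
      exact le_mul_of_one_le_right (Real.exp_pos _).le (Real.one_le_exp (by positivity))
    have hq1 : q ≤ 1 := pow_le_one₀ hη0 hη1.le
    rcases i with _ | j
    · have h1 : E * 1 ≤ E * lam * (F * (1 - q) + q + k * ε) := by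
        rw [mul_assoc]
        refine mul_le_mul_of_nonneg_left ?_ (by linarith)
        refine one_le_mul_of_one_le_of_one_le hlam1 ?_
        have := mul_le_mul_of_nonneg_right hF1 (sub_nonneg.2 hq1)
        linarith
      rw [attemptCost]
      linarith
    · have hj : j ≤ ⌊R / L⌋₊ := by
        have := Nat.ceil_le_floor_add_one (R / L)
        omega
      have h1 := attemptCost_succ_le hη0 hη1.le hκc hlam hF0 hε j
      have h2 : Real.exp (θ * β * c * j) ≤ Real.exp (θ * β * c * ⌊R / L⌋₊) :=
        Real.exp_le_exp.2 (mul_le_mul_of_nonneg_left (by exact_mod_cast hj) hκc)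
      have hpow : q ≤ η ^ (j + 1) := pow_le_pow_of_le_one hη0 hη1.le hi
      have hpow1 : η ^ (j + 1) ≤ 1 := pow_le_one₀ hη0 hη1.le
      have hjk : ((j : ℝ) + 1) ≤ k := by exact_mod_cast hi
      have h3 : F * (1 - η ^ (j + 1)) + η ^ (j + 1) + (j + 1) * ε
          ≤ F * (1 - q) + q + k * ε := by
        -- As `1 ≤ F`, moving weight from 1 to `F` only increases the average, so the full number of
        -- steps is the worst case.
        have h4 := mul_le_mul_of_nonneg_left hpow (sub_nonneg.2 hF1)
        have h5 := mul_le_mul_of_nonneg_right hjk hε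
        linarith
      have h6 : 0 ≤ F * (1 - η ^ (j + 1)) + η ^ (j + 1) + (j + 1) * ε := by
        have : 0 ≤ 1 - η ^ (j + 1) := by linarith
        positivity
      calc _ ≤ Real.exp (θ * β * R) * (lam * Real.exp (θ * β * c * ⌊R / L⌋₊) *
            (F * (1 - q) + q + k * ε)) := by
            refine mul_le_mul_of_nonneg_left (h1.trans ?_) (Real.exp_pos _).le
            exact mul_le_mul (mul_le_mul_of_nonneg_left h2 (by linarith)) h3 h6
              (mul_nonneg (by linarith) (Real.exp_pos _).le)
        _ = E * lam * (F * (1 - q) + q + k * ε) := by rw [← hexpR]; ring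
        _ = F := hFeq
        _ ≤ F := le_rfl
  · intro D hD
    have h1 := lintegral_rpow_le_rpow_lintegral (P := μ) (p := θ / 2)
      (f := fun X : ℝ => ENNReal.ofReal (Real.exp ((1 + dl) * β * X - 2 * β * D)
        + Real.exp (-((1 - dl) * β * X)))) (by fun_prop) (by linarith) (by linarith)
    have h2 : ∀ X : ℝ, ENNReal.ofReal ((Real.exp ((1 + dl) * β * X - 2 * β * D)
        + Real.exp (-((1 - dl) * β * X))) ^ (θ / 2))
        = ENNReal.ofReal (Real.exp ((1 + dl) * β * X - 2 * β * D)
        + Real.exp (-((1 - dl) * β * X))) ^ (θ / 2) := fun X =>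
      (ENNReal.ofReal_rpow_of_pos (by positivity)).symm
    simp_rw [h2]
    refine h1.trans ?_
    rw [← ENNReal.ofReal_rpow_of_nonneg hρ0 (by linarith)]
    exact ENNReal.rpow_le_rpow (hjump D hD) (by linarith)
  · have h1 := mul_le_mul_of_nonneg_right hF1 (show 0 ≤ 1 - ρ ^ (θ / 2) by linarith)
    linarith

/-- The earlier epoch is 0 and the gap is `x`. Up to `R` the attempt cost is bounded by `F`; beyond
`R` the exponent has the factor `(1 + dl) / 2 ≤ 1`. -/
theorem pairPotential_initialPair_le {μ : Measure ℝ} {β θ dl R c L η lam ε F r : ℝ} {v : ℕ → ℝ}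
    (h : DriftParams μ β θ dl R c L η lam ε F r v) (hF : 1 ≤ F) {x : ℝ} (hx : 0 ≤ x) :
    pairPotential (θ * β) dl R L F v (initialPair x) ≤
      Real.exp (θ * β * x * (if R < x then 1 else 0)) * F := by
  have hκ : 0 ≤ θ * β := mul_nonneg h.θ_nonneg h.β_nonneg
  rcases hx.eq_or_lt with rfl | hx
  · simpa [pairPotential, initialPair] using hF
  · have h1 : ¬ (initialPair x).1.1 = (initialPair x).2.1.1 := hx.ne'
    rw [pairPotential, if_neg h1]
    change gapPotential (θ * β) dl R L F v (min x 0) (max x 0) ≤ _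
    rw [min_eq_right hx.le, max_eq_left hx.le, gapPotential, mul_zero, Real.exp_zero, one_mul,
      sub_zero]
    rcases le_or_gt x R with hxR | hxR
    · rw [if_pos hxR, if_neg (not_lt.2 hxR), mul_zero, Real.exp_zero, one_mul]
      exact (mul_le_mul_of_nonneg_right (Real.exp_le_exp.2 (mul_le_mul_of_nonneg_left hxR hκ))
        (h.v_nonneg _)).trans
        (h.v_le _ (Nat.ceil_mono (div_le_div_of_nonneg_right hxR h.L_pos.le)))
    · rw [if_neg (not_le.2 hxR), if_pos hxR, mul_one, mul_comm F]
      refine mul_le_mul_of_nonneg_right (Real.exp_le_exp.2 ?_) h.F_nonneg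
      have : θ * β * x * dl ≤ θ * β * x * 1 :=
        mul_le_mul_of_nonneg_left h.dl_le (mul_nonneg hκ hx.le)
      linarith

theorem measureReal_gt_le_of_lintegral_exp_le {Ω : Type*} [MeasurableSpace Ω] {P : Measure Ω}
    [IsProbabilityMeasure P] {τ : Ω → ℝ} (hτ : Measurable τ) {s B : ℝ} (hs : 0 ≤ s) (hB : 0 ≤ B)
    (h : ∫⁻ ω, ENNReal.ofReal (Real.exp (s * τ ω)) ∂P ≤ ENNReal.ofReal B) (t : ℝ) :
    P.real {ω | t < τ ω} ≤ B * Real.exp (-(s * t)) := by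
  have h1 := mul_meas_ge_le_lintegral (μ := P)
    (f := fun ω => ENNReal.ofReal (Real.exp (s * τ ω))) (by fun_prop)
    (ENNReal.ofReal (Real.exp (s * t)))
  have h2 : P {ω | t < τ ω} ≤
      P {ω | ENNReal.ofReal (Real.exp (s * t)) ≤ ENNReal.ofReal (Real.exp (s * τ ω))} :=
    measure_mono fun ω hω => ENNReal.ofReal_le_ofReal (Real.exp_le_exp.2
      (mul_le_mul_of_nonneg_left (le_of_lt hω) hs))
  have h3 : ENNReal.ofReal (Real.exp (s * t)) * P {ω | t < τ ω} ≤ ENNReal.ofReal B :=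
    (mul_le_mul_right h2 _).trans (h1.trans h)
  have h4 := ENNReal.toReal_mono ENNReal.ofReal_ne_top h3
  rw [ENNReal.toReal_mul, ENNReal.toReal_ofReal (Real.exp_pos _).le,
    ENNReal.toReal_ofReal hB] at h4
  rw [Real.exp_neg, ← div_eq_mul_inv, le_div_iff₀ (Real.exp_pos _), mul_comm]
  exact h4

open Filter Topology in
theorem exists_rpow_mul_lt_one {a p : ℝ} (ha : 0 < a) (hp : p < 1) :
    ∃ θ : ℝ, 0 < θ ∧ θ ≤ 1 ∧ a ^ θ * p < 1 := by
  have h1 : Tendsto (fun θ : ℝ => a ^ θ * p) (𝓝[>] 0) (𝓝 (a ^ (0 : ℝ) * p)) :=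
    (((Real.continuousAt_const_rpow ha.ne').tendsto).mono_left nhdsWithin_le_nhds).mul_const p
  rw [Real.rpow_zero, one_mul] at h1
  obtain ⟨θ, h, h0, hθ⟩ := ((h1.eventually (gt_mem_nhds hp)).and
    (Ioc_mem_nhdsGT (zero_lt_one' ℝ))).exists
  exact ⟨θ, h0, hθ, h⟩

/-- For `δ > 0` the Lyapunov function without time weight has strictly positive drift. -/
theorem exists_driftParams_unweighted (μ : Measure ℝ) [IsProbabilityMeasure μ]
    (hμ : ∀ᵐ r ∂μ, 0 < r) {c L η : ℝ} (hL : 0 < L) (hLc : L ≤ c) (hη0 : 0 < η) (hη1 : η < 1)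
    (hcond : 0 < μ (Set.Ioi (c + L))) {β δ : ℝ} (hβ : 0 < β) (hδ0 : 0 < δ) (hδ1 : δ < 1)
    (hfin : laplace μ ((1 + δ) * β) < ∞) :
    ∃ θ lam ε F r v, 0 < ε ∧
      DriftParams μ β θ 0 (criticalRadius μ δ β) c L η lam ε F r v := by
  obtain ⟨hRpos, hb, hcrit⟩ := criticalRadius_spec hμ hβ hδ0.le hδ1 hfin.ne
  generalize criticalRadius μ δ β = R at *
  have ha0 : laplace μ ((1 + 0) * β) ≠ ∞ :=
    ne_top_of_le_ne_top hfin.ne (laplace_mono hμ (by nlinarith))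
  -- Here `δ > 0` creates the slack: replacing `δ` by 0 at the same radius strictly lowers the left
  -- side of the critical equation.
  have hb0lt : laplace μ (-((1 - 0) * β)) < laplace μ (-((1 - δ) * β)) := by
    have hlt : -((1 - 0) * β) < -((1 - δ) * β) := by nlinarith
    exact laplace_strictMono hμ hlt (ne_top_of_le_ne_top hb (laplace_mono hμ hlt.le))
  have hjump := fun D (hD : R < D) => lintegral_jump_le (dl := 0) hβ.le hD ha0 hb0lt.ne_top
  have hρ0 : 0 ≤ Real.exp (-(2 * β * R)) * (laplace μ ((1 + 0) * β)).toReal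
      + (laplace μ (-((1 - 0) * β))).toReal :=
    add_nonneg (mul_nonneg (Real.exp_pos _).le ENNReal.toReal_nonneg) ENNReal.toReal_nonneg
  have hρ1 : Real.exp (-(2 * β * R)) * (laplace μ ((1 + 0) * β)).toReal
      + (laplace μ (-((1 - 0) * β))).toReal < 1 := by
    refine lt_of_lt_of_eq ?_ hcrit
    refine add_lt_add_of_le_of_lt (mul_le_mul_of_nonneg_left (ENNReal.toReal_mono hfin.ne
      (laplace_mono hμ (by nlinarith))) (Real.exp_pos _).le) ?_
    exact (ENNReal.toReal_lt_toReal hb0lt.ne_top hb).2 hb0lt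
  generalize Real.exp (-(2 * β * R)) * (laplace μ ((1 + 0) * β)).toReal
      + (laplace μ (-((1 - 0) * β))).toReal = ρ at *
  have hbar : laplaceBar μ (c + L) β ≠ ∞ :=
    laplaceBar_ne_top hcond (ne_top_of_le_ne_top ha0 (laplace_mono hμ (by linarith)))
  have hlam : 0 < (laplaceBar μ (c + L) β).toReal := by
    refine ENNReal.toReal_pos ?_ hbar
    exact ((ENNReal.ofReal_pos.2 (Real.exp_pos _)).trans_le
      (exp_le_laplaceBar hcond hβ.le)).ne'
  have hq1 : 1 - η ^ ⌈R / L⌉₊ < 1 := by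
    have := pow_pos hη0 ⌈R / L⌉₊
    linarith
  -- By Jensen the cycle factor at `θ` is at most the `θ`-th power of the one at 1. This power tends
  -- to 1 as `θ → 0`, while `1 - η ^ ⌈R / L⌉₊ < 1`.
  obtain ⟨θ, hθ, hθ1, hA⟩ := exists_rpow_mul_lt_one
    (mul_pos (Real.exp_pos (β * (R + ⌊R / L⌋₊ * c))) hlam) hq1
  have hprob := isProbabilityMeasure_condMaxLaw hcond
  have hbarθ : laplaceBar μ (c + L) (θ * β)
      ≤ ENNReal.ofReal ((laplaceBar μ (c + L) β).toReal ^ θ) := by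
    rw [← ENNReal.ofReal_rpow_of_pos hlam, ENNReal.ofReal_toReal hbar]
    exact laplace_rpow_le hθ hθ1
  have hAθ : Real.exp (θ * β * (R + ⌊R / L⌋₊ * c)) * (laplaceBar μ (c + L) β).toReal ^ θ
      * (1 - η ^ ⌈R / L⌉₊) < 1 := by
    rw [Real.mul_rpow (Real.exp_pos _).le hlam.le, ← Real.exp_mul] at hA
    rwa [show θ * β * (R + ⌊R / L⌋₊ * c) = β * (R + ⌊R / L⌋₊ * c) * θ by ring]
  have hθ2 : 0 < θ / 2 := by positivity
  have hε := sub_pos.2 (Real.rpow_lt_one hρ0 hρ1 hθ2)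
  obtain ⟨F, v, -, -, h⟩ := exists_driftParams hcond hβ.le hθ hθ1 le_rfl zero_le_one hRpos.le hL
    hLc hη0.le hη1 hbarθ hAθ hρ0 hjump hε.le (add_sub_cancel _ _).le
  exact ⟨θ, _, _, F, _, v, hε, h⟩

/-- The coupling, and the bound on its time, for strictly positive parameters. -/
theorem exists_coupling_of_pos (μ : Measure ℝ) [IsProbabilityMeasure μ] (hμ : ∀ᵐ r ∂μ, 0 < r)
    (hexp : HasExpMoment μ) {c L ηt : ℝ} (hunif : HasUniformComponent μ c L ηt)
    (hcond : 0 < μ (Set.Ioi (c + L))) {β δ : ℝ} (hβ : 0 < β) (hδ0 : 0 < δ) (hδ1 : δ < 1)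
    (hfin : laplace μ ((1 + δ) * β) < ∞) {η : ℝ} (hη : η = ηt / 2)
    {R : ℝ} (hR : R = criticalRadius μ δ β) {x : ℝ} (hx : 0 ≤ x) :
    ∃ (Ω : Type) (_ : MeasurableSpace Ω) (P : Measure Ω) (_ : IsProbabilityMeasure P)
      (T T' : ℕ → Ω → ℝ) (τ : Ω → ℝ),
      IsRenewalProcess P μ x T ∧ IsRenewalProcess P μ 0 T' ∧ IsCouplingTime P T T' τ ∧
      ∀ θ lam : ℝ, 0 < θ → θ ≤ 1 → laplaceBar μ (c + L) (θ * β) ≤ ENNReal.ofReal lam →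
        Real.exp (θ * β * (R + ⌊R / L⌋₊ * c)) * lam * (1 - η ^ ⌈R / L⌉₊) < 1 →
        ∀ t : ℝ, P.real {ω | t < τ ω} ≤
            Real.exp (θ * β * x * (if R < x then 1 else 0)) *
              (η ^ ⌈R / L⌉₊ * Real.exp (θ * β * (R + ⌊R / L⌋₊ * c)) * lam
                / (1 - Real.exp (θ * β * (R + ⌊R / L⌋₊ * c)) * lam * (1 - η ^ ⌈R / L⌉₊))) *
              Real.exp (-(θ * δ * β * t)) := by
  have hunif' := hunif
  obtain ⟨hL, hLc, hηt0, hηt1, -⟩ := hunif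
  have hη0 : 0 < η := by linarith
  have hη1 : η < 1 := by linarith
  have hle : ∀ l, 0 ≤ l → l ≤ L → (uniformPart c L η).map (· + l) ≤ μ := fun l h0 hl =>
    hη ▸ uniformPart_map_le hunif' h0 hl
  obtain ⟨hRpos, hb, hcrit⟩ := criticalRadius_spec hμ hβ hδ0.le hδ1 hfin.ne
  obtain ⟨θ₀, lam₀, ε₀, F₀, r₀, v₀, hε₀, h₀⟩ := exists_driftParams_unweighted μ hμ hL hLc hη0 hη1
    hcond hβ hδ0 hδ1 hfin
  rw [← hR] at hRpos hcrit h₀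
  obtain ⟨Ω, mΩ, P, hP, T, T', τ, hT, hT', hτ, hbound⟩ := exists_coupling hμ
    (integrable_id_of_hasExpMoment hμ hexp) hcond hle hε₀ h₀ hx
  refine ⟨Ω, mΩ, P, hP, T, T', τ, hT, hT', hτ, fun θ lam hθ hθ1 hlam hA t => ?_⟩
  -- With the time weight the critical equation gives mean at most 1 and no slack, so `ε = 0`. That
  -- suffices, because the meeting is already known.
  have hjump : ∀ D, R < D → ∫⁻ X, ENNReal.ofReal (Real.exp ((1 + δ) * β * X - 2 * β * D)
      + Real.exp (-((1 - δ) * β * X))) ∂μ ≤ ENNReal.ofReal 1 := fun D hD =>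
    (lintegral_jump_le hβ.le hD hfin.ne hb).trans_eq (by rw [hcrit])
  obtain ⟨F, v, hF, hF1, h⟩ := exists_driftParams hcond hβ.le hθ hθ1 hδ0.le hδ1.le hRpos.le hL hLc
    hη0.le hη1 hlam hA zero_le_one hjump le_rfl (by simp)
  have hV := pairPotential_initialPair_le h hF1 hx
  have h1 := measureReal_gt_le_of_lintegral_exp_le (s := θ * β * δ) hτ.measurable
    (by positivity) (mul_nonneg (Real.exp_pos _).le h.F_nonneg)
    ((hbound _ _ _ _ _ _ _ _ h).trans (ENNReal.ofReal_le_ofReal hV)) t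
  rw [hF, mul_zero, add_zero] at h1
  rw [show θ * δ * β * t = θ * β * δ * t by ring,
    mul_assoc (η ^ _), mul_comm (η ^ _) (Real.exp _ * lam)]
  exact h1

theorem theorem1p1
    -- the law of the inter-arrival time `X > 0`
    (μ : Measure ℝ) [IsProbabilityMeasure μ] (hμ : ∀ᵐ r ∂μ, 0 < r)
    (hexp : HasExpMoment μ)
    (c L ηt : ℝ) (hunif : HasUniformComponent μ c L ηt)
    -- the event on which one conditions in `laplaceBar` has positive probability
    (hcond : 0 < μ (Set.Ioi (c + L)))
    (β δ : ℝ) (hβ : 0 ≤ β) (hδ0 : 0 ≤ δ) (hδ1 : δ < 1)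
    (hfin : laplace μ ((1 + δ) * β) < ∞)
    (η : ℝ) (hη : η = ηt / 2)
    (R : ℝ) (hR : R = criticalRadius μ δ β)
    (x : ℝ) (hx : 0 ≤ x) :
    ∃ (Ω : Type) (_ : MeasurableSpace Ω) (P : Measure Ω) (_ : IsProbabilityMeasure P)
      (T T' : ℕ → Ω → ℝ) (τ : Ω → ℝ),
      IsRenewalProcess P μ x T ∧ IsRenewalProcess P μ 0 T' ∧ IsCouplingTime P T T' τ ∧
      ∀ θ : ℝ, 0 < θ → θ ≤ 1 →
        ENNReal.ofReal (Real.exp (θ * β * (R + ⌊R / L⌋₊ * c))) * laplaceBar μ (c + L) (θ * β)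
          * ENNReal.ofReal (1 - η ^ ⌈R / L⌉₊) < 1 →
        ∀ t : ℝ, x ≤ t →
          P.real {ω | t < τ ω} ≤
            Real.exp (θ * β * x * (if R < x then 1 else 0)) *
              (η ^ ⌈R / L⌉₊ * Real.exp (θ * β * (R + ⌊R / L⌋₊ * c))
                  * (laplaceBar μ (c + L) (θ * β)).toReal
                / (1 - Real.exp (θ * β * (R + ⌊R / L⌋₊ * c))
                  * (laplaceBar μ (c + L) (θ * β)).toReal * (1 - η ^ ⌈R / L⌉₊))) *
              Real.exp (-(θ * δ * β * t)) := by
  have hbar : ∀ θ, 0 < θ → θ ≤ 1 → laplaceBar μ (c + L) (θ * β) ≠ ∞ := fun θ hθ hθ1 =>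
    laplaceBar_ne_top hcond (ne_top_of_le_ne_top hfin.ne (laplace_mono hμ
      (mul_le_mul_of_nonneg_right (by linarith) hβ)))
  have hreal : ∀ θ, 0 < θ → θ ≤ 1 →
      ENNReal.ofReal (Real.exp (θ * β * (R + ⌊R / L⌋₊ * c))) * laplaceBar μ (c + L) (θ * β)
          * ENNReal.ofReal (1 - η ^ ⌈R / L⌉₊) < 1 →
      Real.exp (θ * β * (R + ⌊R / L⌋₊ * c)) * (laplaceBar μ (c + L) (θ * β)).toReal
          * (1 - η ^ ⌈R / L⌉₊) < 1 := by
    intro θ hθ hθ1 h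
    rw [← ENNReal.ofReal_toReal (hbar θ hθ hθ1), ← ENNReal.ofReal_mul (Real.exp_pos _).le,
      ← ENNReal.ofReal_mul (mul_nonneg (Real.exp_pos _).le ENNReal.toReal_nonneg),
      ← ENNReal.ofReal_one, ENNReal.ofReal_lt_ofReal_iff one_pos] at h
    exact h
  by_cases hpos : 0 < β ∧ 0 < δ
  · obtain ⟨Ω, mΩ, P, hP, T, T', τ, hT, hT', hτ, hbound⟩ :=
      exists_coupling_of_pos μ hμ hexp hunif hcond hpos.1 hpos.2 hδ1 hfin hη hR hx
    refine ⟨Ω, mΩ, P, hP, T, T', τ, hT, hT', hτ, fun θ hθ hθ1 h t _ => ?_⟩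
    exact hbound θ _ hθ hθ1 (ENNReal.ofReal_toReal (hbar θ hθ hθ1)).ge (hreal θ hθ hθ1 h) t
  · -- without exponential decay the bound is trivial, and any coupling will do
    have hδβ : δ * β = 0 := by
      by_contra hne
      exact hpos ⟨hβ.lt_of_ne' (right_ne_zero_of_mul hne), hδ0.lt_of_ne' (left_ne_zero_of_mul hne)⟩
    have hexp' := hexp
    obtain ⟨α, hα, hαfin⟩ := hexp
    -- Rates `α / 2` and `1 / 2` are admissible because `(1 + 1/2) * (α / 2) ≤ α`. The coupling uses
    -- their critical radius instead of `R`.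
    obtain ⟨Ω, mΩ, P, hP, T, T', τ, hT, hT', hτ, -⟩ :=
      exists_coupling_of_pos μ hμ hexp' hunif hcond (half_pos hα) (one_half_pos (α := ℝ))
        one_half_lt_one ((laplace_mono hμ (by linarith)).trans_lt hαfin) hη rfl hx
    refine ⟨Ω, mΩ, P, hP, T, T', τ, hT, hT', hτ, fun θ hθ hθ1 h t _ => ?_⟩
    obtain ⟨hL, hLc, -, -, -⟩ := hunif
    have hκ : 0 ≤ θ * β := mul_nonneg hθ.le hβ
    have hR0 : 0 ≤ R := by
      rcases hβ.eq_or_lt with h0 | h0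
      -- For `β = 0` division by zero returns 0, hence `R = 0`.
      · rw [hR, criticalRadius, ← h0]; simp
      · exact hR ▸ (criticalRadius_spec hμ h0 hδ0 hδ1 hfin.ne).1.le
    have hA : 1 ≤ Real.exp (θ * β * (R + ⌊R / L⌋₊ * c))
        * (laplaceBar μ (c + L) (θ * β)).toReal := by
      have hc : 0 ≤ c := hL.le.trans hLc
      refine one_le_mul_of_one_le_of_one_le (Real.one_le_exp (mul_nonneg hκ (by positivity))) ?_
      have h1 : (1 : ℝ≥0∞) ≤ laplaceBar μ (c + L) (θ * β) := by
        refine le_trans ?_ (exp_le_laplaceBar hcond hκ)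
        rw [← ENNReal.ofReal_one]
        exact ENNReal.ofReal_le_ofReal (Real.one_le_exp (mul_nonneg hκ (by linarith)))
      simpa using ENNReal.toReal_mono (hbar θ hθ hθ1) h1
    have hcycle := one_le_cycleCost hA le_rfl (hreal θ hθ hθ1 h)
    rw [add_zero] at hcycle
    have hlast : Real.exp (-(θ * δ * β * t)) = 1 := by
      rw [show θ * δ * β * t = θ * (δ * β) * t by ring, hδβ]; simp
    have hfirst : 1 ≤ Real.exp (θ * β * x * (if R < x then 1 else 0)) := by
      refine Real.one_le_exp (mul_nonneg (mul_nonneg hκ hx) ?_)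
      split_ifs <;> norm_num
    rw [hlast, mul_one]
    refine measureReal_le_one.trans (one_le_mul_of_one_le_of_one_le hfirst (hcycle.trans_eq ?_))
    congr 1
    ring
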